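/- A set function over $U=\{1,\dots,n\}$ is a map $f:2^U\to\mathbb R$. It is weakly $\epsilon$-modular if $|f(S)+f(T)-f(S\cup T)-f(S\cap T)|\le\epsilon$ for all disjoint $S,T\subseteq U$. It is $\Delta$-linear if there are reals $c_0,c_1,\dots,c_n$ with $|f(S)-c_0-\sum_{i\in S}c_i|\le\Delta$ for every $S\subseteq U$, and tightly $\Delta$-linear if moreover it is not $\Delta'$-linear for any $\Delta'<\Delta$. The weak Kalton constant $K_w$ is the smallest $K\ge 0$ such that for all $n$ and all $\epsilon\ge0$ every weakly $\epsilon$-modular set function over $\{1,\dots,n\}$ is $K\epsilon$-linear; equivalently, every such function is $K_w\epsilon$-linear, while for all $\kappa<K_w$ and $\epsilon>0$ there are an $n$ and a weakly $\epsilon$-modular function over $\{1,\dots,n\}$ that is not $\kappa\epsilon$-linear. A collection $S_1,\dots,S_{2k}\subseteq U$ with $k\ge1$ is a canonical generating collection if $n=\binom{2k}{k}$, $\bigcup_j S_j=U$, $\bigcap_{j:\,i\in S_j}S_j=\{i\}$ for every item $i$, every item lies in exactly $k$ of the $S_j$, and every $S_j$ has $n/2$ items. A circuit computes a set from input sets by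 intersections, unions and complements; the dual circuit exchanges intersections and unions. For integers $k\ge2$, $M\ge1$ and $n=\binom{2k}{k}$, a set function $f$ over $U$ is $(k,M)$-symmetric if the zero function is a closest linear function to $f$ and there are sets $P_1,\dots,P_{2k}\subseteq U$ such that: (1) $f$ is integer valued; (2) $f(\bar S)=-f(S)$ for every $S$, where $\bar S=U\setminus S$; (3) $f(P_j)=M$ and $f(\bar P_j)=-M$ for all $j$, both $P_1,\dots,P_{2k}$ and $\bar P_1,\dots,\bar P_{2k}$ are canonical generating collections, and they are a positive and a negative support of $f$, i.e. $\{P_j\}$ and $\{\bar P_j\}$ are the supports of two rational probability distributions on sets of value $\max|f|$ and $-\max|f|$, respectively, that give each item the same probability of lying in the random set; (4) for every circuit with $2k$ inputs, the value under $f$ of its output, when $P_1,\dots,P_{2k}$ are assigned to its inputs by a permutation, does not depend on the permutation; (5) $f(S)=f(\hat S)$ whenever a circuit on inputs $P_1,\dots,P_{2k}$ (in some order) outputs $S$ and its dual circuit outputs $\hat S$. Theorem. For every $n$ and every $\epsilon>0$, every weakly $\epsilon$-modular set function over $\{1,\dots,n\}$ is $\Delta$-linear for some $\Delta<24\epsilon$.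 The weak Kalton constant $K_w$ exists, is unique, and satisfies $K_w<24$; in fact $K_w\le 23.811$. Moreover, there is an integer valued set function over $20$ items that is weakly $2$-modular, tightly $3$-linear and $(3,3)$-symmetric. Hence $K_w\ge 3/2$. -/

import Mathlib

/-! Set functions over the ground set `U = Fin n` are maps `f : Finset (Fin n) → ℝ`. -/

namespace SetFn

/-- `f` is weakly `ε`-modular: the approximate modular equation holds for disjoint `S`, `T`. -/
def IsWeaklyModular {n : ℕ} (ε : ℝ) (f : Finset (Fin n) → ℝ) : Prop :=
  ∀ S T : Finset (Fin n), Disjoint S T → |f S + f T - f (S ∪ T) - f (S ∩ T)| ≤ ε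

/-- `f S = c₀ + ∑ i ∈ S, c i` for some constants. -/
def IsLinear {n : ℕ} (f : Finset (Fin n) → ℝ) : Prop :=
  ∃ (c₀ : ℝ) (c : Fin n → ℝ), ∀ S : Finset (Fin n), f S = c₀ + ∑ i ∈ S, c i

/-- `f` and `g` are `Δ`-close on every set. -/
def IsClose {n : ℕ} (Δ : ℝ) (f g : Finset (Fin n) → ℝ) : Prop :=
  ∀ S : Finset (Fin n), |f S - g S| ≤ Δ

/-- `f` is `Δ`-linear: some linear set function is `Δ`-close to `f`. -/
def IsDeltaLinear {n : ℕ} (Δ : ℝ) (f : Finset (Fin n) → ℝ) : Prop :=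
  ∃ l : Finset (Fin n) → ℝ, IsLinear l ∧ IsClose Δ f l

/-- `f` is tightly `Δ`-linear. -/
def IsTightlyLinear {n : ℕ} (Δ : ℝ) (f : Finset (Fin n) → ℝ) : Prop :=
  IsDeltaLinear Δ f ∧ ∀ Δ' : ℝ, Δ' < Δ → ¬ IsDeltaLinear Δ' f

/-- `l` is a closest linear function to `f`. -/
def IsClosestLinear {n : ℕ} (l f : Finset (Fin n) → ℝ) : Prop :=
  IsLinear l ∧ ∃ Δ : ℝ, IsTightlyLinear Δ f ∧ IsClose Δ f l

/-- `f` attains only integer values. -/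
def IsIntegerValued {n : ℕ} (f : Finset (Fin n) → ℝ) : Prop :=
  ∀ S : Finset (Fin n), ∃ z : ℤ, f S = (z : ℝ)

/-- `K` is the weak Kalton constant: every weakly `ε`-modular set function is `K ε`-linear, and no
smaller constant `κ` has this property, for any `ε > 0`. -/
structure IsWeakKaltonConstant (K : ℝ) : Prop where
  nonneg : 0 ≤ K
  upper : ∀ (n : ℕ) (ε : ℝ), 0 ≤ ε → ∀ f : Finset (Fin n) → ℝ,
    IsWeaklyModular ε f → IsDeltaLinear (K * ε) f
  sharp : ∀ κ : ℝ, κ < K → ∀ ε : ℝ, 0 < ε → ∃ (n : ℕ) (f : Finset (Fin n) → ℝ),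
    IsWeaklyModular ε f ∧ ¬ IsDeltaLinear (κ * ε) f

/-! ### Generating collections and circuits -/

/-- The collection `G 0, …, G (g - 1)` is generating: covering and item-differentiating. -/
structure IsGenerating {g n : ℕ} (G : Fin g → Finset (Fin n)) : Prop where
  covering : ⋃ j, (G j : Set (Fin n)) = Set.univ
  differentiating : ∀ i : Fin n, ⋂ j ∈ {j | i ∈ G j}, (G j : Set (Fin n)) = {i}

/-- A canonical generating collection of `2 k` sets. -/
structure IsCanonical {n : ℕ} (k : ℕ) (G : Fin (2 * k) → Finset (Fin n)) : Prop where
  pos : 0 < k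
  generating : IsGenerating G
  frequency : ∀ i : Fin n, (Finset.univ.filter fun j => i ∈ G j).card = k
  half : ∀ j, 2 * (G j).card = n
  card_items : n = (2 * k).choose k

/-- Generating circuits with `g` input nodes. A directed acyclic circuit is represented by the
tree of gates obtained by unfolding it at its output node (an input node may occur repeatedly);
this changes neither the set computed nor the set computed by the dual circuit. -/
inductive Circuit (g : ℕ) : Type where
  | input (j : Fin g) : Circuit g
  | compl (C : Circuit g) : Circuit g
  | inter (C D : Circuit g) : Circuit g
  | union (C D : Circuit g) : Circuit g

/-- The set output by a circuit whose `j`-th input node carries the set `G j`. -/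
def Circuit.eval {g n : ℕ} (G : Fin g → Finset (Fin n)) : Circuit g → Finset (Fin n)
  | .input j => G j
  | .compl C => (C.eval G)ᶜ
  | .inter C D => C.eval G ∩ D.eval G
  | .union C D => C.eval G ∪ D.eval G

/-- The dual circuit: intersections and unions are exchanged. -/
def Circuit.dual {g : ℕ} : Circuit g → Circuit g
  | .input j => .input j
  | .compl C => .compl C.dual
  | .inter C D => .union C.dual D.dual
  | .union C D => .inter C.dual D.dual

/-- `T` is the dual of `S` with respect to the collection `G`: some circuit, for some assignment of
the sets of `G` to its input nodes, outputs `S`, and its dual circuit outputs `T`. -/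
def IsDual {g n : ℕ} (G : Fin g → Finset (Fin n)) (S T : Finset (Fin n)) : Prop :=
  ∃ (C : Circuit g) (σ : Equiv.Perm (Fin g)),
    C.eval (fun j => G (σ j)) = S ∧ C.dual.eval (fun j => G (σ j)) = T

/-! ### Positive and negative supports, and `(k, M)`-symmetric functions -/

/-- A rational probability distribution over sets. -/
structure IsDistribution {n : ℕ} (p : Finset (Fin n) → ℚ) : Prop where
  nonneg : ∀ S, 0 ≤ p S
  sum_eq_one : ∑ S, p S = 1

/-- The probability that the item `i` lies in a random set drawn from `p`. -/
def marginal {n : ℕ} (p : Finset (Fin n) → ℚ) (i : Fin n) : ℚ :=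
  ∑ S ∈ Finset.univ.filter (fun S : Finset (Fin n) => i ∈ S), p S

/-- `PS` and `NS` are a positive and a negative support of `f`: the supports of two rational
distributions with equal item marginals, over sets of value `M` and `-M` respectively, where `M` is
the maximum absolute value of `f`. -/
def IsSupportPair {n : ℕ} (f : Finset (Fin n) → ℝ) (PS NS : Set (Finset (Fin n))) : Prop :=
  ∃ (M : ℝ) (p q : Finset (Fin n) → ℚ),
    IsGreatest (Set.range fun S => |f S|) M ∧ IsDistribution p ∧ IsDistribution q ∧
    (∀ S, 0 < p S → f S = M) ∧ (∀ S, 0 < q S → f S = -M) ∧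
    (∀ i, marginal p i = marginal q i) ∧ PS = {S | 0 < p S} ∧ NS = {S | 0 < q S}

/-- `f` is `(k, M)`-symmetric, with positive support `P 0, …, P (2 k - 1)`. -/
structure IsSymmetricWith {n : ℕ} (k : ℕ) (M : ℤ) (P : Fin (2 * k) → Finset (Fin n))
    (f : Finset (Fin n) → ℝ) : Prop where
  two_le : 2 ≤ k
  one_le : 1 ≤ M
  card_items : n = (2 * k).choose k
  closest_zero : IsClosestLinear (fun _ => 0) f
  integrality : IsIntegerValued f
  antisymmetry : ∀ S, f S = -f Sᶜ
  supports : IsSupportPair f (Set.range P) (Set.range fun j => (P j)ᶜ)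
  value_pos : ∀ j, f (P j) = M
  value_neg : ∀ j, f (P j)ᶜ = -M
  canonical_pos : IsCanonical k P
  canonical_neg : IsCanonical k fun j => (P j)ᶜ
  anonymity : ∀ (C : Circuit (2 * k)) (σ τ : Equiv.Perm (Fin (2 * k))),
    f (C.eval fun j => P (σ j)) = f (C.eval fun j => P (τ j))
  dual_symmetry : ∀ S T, IsDual P S T → f S = f T

/-- `f` is `(k, M)`-symmetric. -/
def IsKMSymmetric {n : ℕ} (k : ℕ) (M : ℤ) (f : Finset (Fin n) → ℝ) : Prop :=
  ∃ P : Fin (2 * k) → Finset (Fin n), IsSymmetricWith k M P f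

end SetFn

/-!
**Upper bound.** Let `M` be the distance of a weakly `ε`-modular `f` to the linear functions, and
replace `f` by its difference `g` to a closest one, so that `|g| ≤ M`. By Hahn-Banach in the quotient
by the linear functions (`exists_dual_weights`) there are probability distributions `p`, `q` on sets,
with the same probability `x i` that an item `i` is contained, whose averages of `g` differ by at
least `2 M`. Draw `P` from `p` and `N` from `q` independently. Removing `P ∩ N` from both, the
averages of `g (P \ N)` and `g (N \ P)` still differ by at least `2 M - 2 ε`, and now every item lies
in either random set with probability `x i * (1 - x i) ≤ 1 / 4`.

This is the regime in which good expanders exist: a random bipartite graph with `4 t` left vertices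
of degree `3` and `3 t` right vertices of degree `4` satisfies Hall's condition for all sets of at
most `t` left vertices (`exists_expander`). Given `4 t` sets containing each item at most `t` times,
put them at the left vertices and move each item, along a matching, to the right vertices
(`sum_le_of_expander`). The total value changes by at most `(2 * 4 t + 3 * 3 t) ε = 17 t ε`, while
only `3 t` sets are left, so that a family with average value `A` in a function bounded by `B` has
`A ≤ 3 / 4 * B + 17 / 4 * ε` (`sum_weight_le`). Applied to `g - g ∅` and `g ∅ - g` this gives
`2 M - 2 ε ≤ 3 / 2 * M + 17 / 2 * ε`, that is, `M ≤ 21 ε` (`linDist_le`). Existence, uniqueness and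
sharpness of the weak Kalton constant follow by scaling, since the distance to the linear functions
is attained.

**Lower bound.** The twenty items are the `3`-element subsets of `{0, …, 5}`, and `P j` is the set of
items containing `j`. Any three of the `P j` meet, and any three miss a common item. These two
properties alone make the following antisymmetric function weakly `2`-modular: it is `3` on the
`P j`, and `1` on the other sets that lie below some `P j` and no `(P k)ᶜ`, or above some `P j` and no
`(P k)ᶜ` (`isWeaklyModular_familyFn`). Its construction from the family is invariant under
reindexing and under permutations of the items, and changes sign when the family is replaced by the
family of complements. As permuting `{0, …, 5}` and complementing the subsets are permutations of
the items, anonymity and duality symmetry follow.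
-/

namespace SetFn

/-! ### Random biregular graphs -/

/-- Among all bijections `α ≃ β`, those sending `A` into `B` form the fraction
`(#B).choose (#A) / (card β).choose (#A)`: the image of `A` is a uniformly random subset. -/
theorem card_equiv_image_subset {α β : Type*} [Fintype α] [Fintype β] [DecidableEq α]
    [DecidableEq β] (A : Finset α) (B : Finset β) :
    (Finset.univ.filter fun π : α ≃ β => A.image π ⊆ B).card * (Fintype.card β).choose A.card
      = Fintype.card (α ≃ β) * B.card.choose A.card := by
  classical
  let c : Finset β → ℕ := fun X => (Finset.univ.filter fun π : α ≃ β => A.image π = X).card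
  -- bijections of `β` permute the possible images transitively
  have hc : ∀ X Y : Finset β, X.card = Y.card → c X ≤ c Y := by
    intro X Y h
    let e : {x // x ∈ X} ≃ {x // x ∈ Y} := Finset.equivOfCardEq h
    let τ : Equiv.Perm β := e.extendSubtype
    have hτ : X.image τ = Y := by
      apply Finset.eq_of_subset_of_card_le
      · intro y hy
        obtain ⟨x, hx, rfl⟩ := Finset.mem_image.1 hy
        exact e.extendSubtype_mem x hx
      · rw [Finset.card_image_of_injective _ τ.injective, h]
    refine Finset.card_le_card_of_injOn (fun π => π.trans τ) ?_ ?_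
    · intro π hπ
      have hπ' : A.image π = X := by simpa using hπ
      simp only [Finset.coe_filter, Finset.mem_univ, true_and, Set.mem_ofPred_eq]
      rw [← hτ, ← hπ', Finset.image_image]
      rfl
    · intro π _ ρ _ h
      ext x
      have := congrArg (fun g : α ≃ β => g x) h
      exact τ.injective this
  have hsum : ∀ F : Finset (Finset β), (Finset.univ.filter fun π : α ≃ β => A.image π ∈ F).card
      = ∑ X ∈ F, c X := by
    intro F
    rw [Finset.card_eq_sum_card_fiberwise (f := fun π : α ≃ β => A.image π) (t := F)]
    · refine Finset.sum_congr rfl fun X hX => ?_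
      congr 1
      ext π
      simp only [Finset.mem_filter, Finset.mem_univ, true_and]
      constructor
      · exact fun h => h.2
      · exact fun h => ⟨h ▸ hX, h⟩
    · intro π hπ
      simpa using hπ
  have hcard : ∀ π : α ≃ β, (A.image π).card = A.card := fun π =>
    Finset.card_image_of_injective _ π.injective
  have h1 : (Finset.univ.filter fun π : α ≃ β => A.image π ⊆ B).card
      = ∑ X ∈ B.powersetCard A.card, c X := by
    rw [← hsum]
    congr 1
    ext π
    simp [Finset.mem_powersetCard, hcard π]
  have h2 : Fintype.card (α ≃ β) = ∑ X ∈ (Finset.univ : Finset β).powersetCard A.card, c X := by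
    rw [← hsum, ← Finset.card_univ]
    congr 1
    ext π
    simp [Finset.mem_powersetCard, hcard π]
  rw [h1, h2, ← Finset.card_univ, ← Finset.card_powersetCard, ← Finset.card_powersetCard]
  have hconst : ∀ (F G : Finset (Finset β)) , (∑ Y ∈ F, c Y) * G.card = ∑ Y ∈ F, ∑ _X ∈ G, c Y := by
    intro F G
    simp [Finset.mul_sum, mul_comm]
  rw [hconst, hconst, Finset.sum_comm]
  refine Finset.sum_congr rfl fun X hX => Finset.sum_congr rfl fun Y hY => ?_
  rw [Finset.mem_powersetCard] at hX hY
  exact le_antisymm (hc _ _ (hY.2.trans hX.2.symm)) (hc _ _ (hX.2.trans hY.2.symm))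

/-- The expected number of pairs `S`, `T` with `#S = #T = s` such that all neighbours of `S` lie
in `T`, in a random bipartite graph with `4 t` left vertices of degree `3` and `3 t` right vertices
of degree `4`. -/
noncomputable def expectedBad (t s : ℕ) : ℝ :=
  (4 * t).choose s * (3 * t).choose s * (4 * s).choose (3 * s) / (12 * t).choose (3 * s)

/-- First moment method: if fewer than one violation of Hall's condition is expected, some
`(3, 4)`-biregular graph satisfies Hall's condition for all sets of at most `t` left vertices. -/
theorem exists_expander_of_expectedBad {t : ℕ}
    (ht : ∑ s ∈ Finset.Icc 1 t, expectedBad t s < 1) :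
    ∃ N : Fin (4 * t) → Finset (Fin (3 * t)), (∀ v, (N v).card ≤ 3) ∧
      (∀ w, (Finset.univ.filter fun v => w ∈ N v).card ≤ 4) ∧
      ∀ S : Finset (Fin (4 * t)), S.card ≤ t → S.card ≤ (S.biUnion N).card := by
  classical
  let V := Fin (4 * t)
  let W := Fin (3 * t)
  let Ω := (V × Fin 3) ≃ (W × Fin 4)
  have hVW : Fintype.card (V × Fin 3) = Fintype.card (W × Fin 4) := by
    simp [V, W]; ring
  have hne : Nonempty Ω := ⟨Fintype.equivOfCardEq hVW⟩
  have hpos : (0 : ℝ) < Fintype.card Ω := by exact_mod_cast Fintype.card_pos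
  let N : Ω → V → Finset W := fun π v => Finset.univ.image fun k : Fin 3 => (π (v, k)).1
  let E : Finset V → Finset W → Finset Ω := fun S T =>
    Finset.univ.filter fun π : Ω => (S ×ˢ (Finset.univ : Finset (Fin 3))).image π ⊆
      T ×ˢ (Finset.univ : Finset (Fin 4))
  let bad : Finset Ω := (Finset.Icc 1 t).biUnion fun s =>
    ((Finset.univ : Finset V).powersetCard s).biUnion fun S =>
      ((Finset.univ : Finset W).powersetCard s).biUnion fun T => E S T
  have hE : ∀ s ∈ Finset.Icc 1 t, ∀ S ∈ (Finset.univ : Finset V).powersetCard s,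
      ∀ T ∈ (Finset.univ : Finset W).powersetCard s, ((E S T).card : ℝ) =
        Fintype.card Ω * ((4 * s).choose (3 * s) / (12 * t).choose (3 * s)) := by
    intro s hs S hS T hT
    have hS' := (Finset.mem_powersetCard.1 hS).2
    have hT' := (Finset.mem_powersetCard.1 hT).2
    have hst := (Finset.mem_Icc.1 hs).2
    have h := card_equiv_image_subset (S ×ˢ (Finset.univ : Finset (Fin 3)))
      (T ×ˢ (Finset.univ : Finset (Fin 4)))
    have h12 : Fintype.card (W × Fin 4) = 12 * t := by simp [W]; ring
    simp only [Finset.card_product, Finset.card_univ, Fintype.card_fin, hS', hT', h12] at h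
    rw [mul_comm s 3, mul_comm s 4] at h
    have hch : (0 : ℝ) < (12 * t).choose (3 * s) := by
      exact_mod_cast Nat.choose_pos (by omega)
    rw [← mul_div_assoc, eq_div_iff hch.ne']
    exact_mod_cast h
  have hbad : (bad.card : ℝ) < Fintype.card Ω := by
    calc (bad.card : ℝ)
        ≤ ∑ s ∈ Finset.Icc 1 t, ∑ S ∈ (Finset.univ : Finset V).powersetCard s,
            ∑ T ∈ (Finset.univ : Finset W).powersetCard s, ((E S T).card : ℝ) := by
          have : bad.card ≤ ∑ s ∈ Finset.Icc 1 t, ∑ S ∈ (Finset.univ : Finset V).powersetCard s,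
            ∑ T ∈ (Finset.univ : Finset W).powersetCard s, (E S T).card :=
            Finset.card_biUnion_le.trans <| Finset.sum_le_sum fun s _ =>
              Finset.card_biUnion_le.trans <| Finset.sum_le_sum fun S _ =>
                Finset.card_biUnion_le
          exact_mod_cast this
      _ = ∑ s ∈ Finset.Icc 1 t, Fintype.card Ω * expectedBad t s := by
          refine Finset.sum_congr rfl fun s hs => ?_
          rw [Finset.sum_congr rfl fun S hS => Finset.sum_congr rfl fun T hT => hE s hs S hS T hT]
          simp only [Finset.sum_const, Finset.card_powersetCard, Finset.card_univ, V, W,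
            Fintype.card_fin, nsmul_eq_mul, expectedBad]
          ring
      _ = Fintype.card Ω * ∑ s ∈ Finset.Icc 1 t, expectedBad t s := by rw [Finset.mul_sum]
      _ < Fintype.card Ω * 1 := by gcongr
      _ = Fintype.card Ω := mul_one _
  obtain ⟨π, hπ⟩ : ∃ π : Ω, π ∉ bad := by
    by_contra! h
    have : bad = Finset.univ := Finset.eq_univ_of_forall h
    rw [this, Finset.card_univ] at hbad
    exact lt_irrefl _ hbad
  refine ⟨N π, fun v => ?_, fun w => ?_, fun S hS => ?_⟩
  · exact Finset.card_image_le.trans (by simp)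
  · have hsub : (Finset.univ.filter fun v => w ∈ N π v) ⊆
        Finset.univ.image fun k : Fin 4 => (π.symm (w, k)).1 := by
      intro v hv
      simp only [N, Finset.mem_filter, Finset.mem_univ, true_and, Finset.mem_image] at hv ⊢
      obtain ⟨k, hk⟩ := hv
      refine ⟨(π (v, k)).2, ?_⟩
      have hpair : (w, (π (v, k)).2) = π (v, k) := Prod.ext hk.symm rfl
      rw [hpair, Equiv.symm_apply_apply]
    exact (Finset.card_le_card hsub).trans (Finset.card_image_le.trans (by simp))
  -- A violating `S` has its neighbours in some `T` with `#T = #S`, so `π` would be bad.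
  · by_contra! hlt
    have hle : S.card ≤ Fintype.card W := by simp [W]; omega
    obtain ⟨T, hT, hTc⟩ := Finset.exists_superset_card_eq hlt.le hle
    apply hπ
    simp only [bad, Finset.mem_biUnion, Finset.mem_Icc, Finset.mem_powersetCard]
    refine ⟨S.card, ⟨by omega, hS⟩, S, ⟨Finset.subset_univ _, rfl⟩, T,
      ⟨Finset.subset_univ _, hTc⟩, ?_⟩
    simp only [E, Finset.mem_filter, Finset.mem_univ, true_and]
    intro x hx
    obtain ⟨⟨v, k⟩, hv, rfl⟩ := Finset.mem_image.1 hx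
    simp only [Finset.mem_product, Finset.mem_univ, and_true] at hv ⊢
    exact hT (Finset.mem_biUnion.2 ⟨v, hv, Finset.mem_image.2 ⟨k, Finset.mem_univ _, rfl⟩⟩)

/-- `a.choose s / b.choose s ≤ (a / b) ^ s`, cleared of denominators. -/
theorem choose_mul_pow_le {a b : ℕ} (h : a ≤ b) (s : ℕ) :
    a.choose s * b ^ s ≤ b.choose s * a ^ s := by
  have key : a.descFactorial s * b ^ s ≤ b.descFactorial s * a ^ s := by
    rw [Nat.descFactorial_eq_prod_range, Nat.descFactorial_eq_prod_range, ← Finset.card_range s,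
      ← Finset.prod_const, ← Finset.prod_const, Finset.card_range, ← Finset.prod_mul_distrib,
      ← Finset.prod_mul_distrib]
    refine Finset.prod_le_prod' fun i _ => ?_
    rw [Nat.sub_mul, Nat.sub_mul, mul_comm b a]
    exact Nat.sub_le_sub_left (Nat.mul_le_mul_left i h) _
  rw [Nat.descFactorial_eq_factorial_mul_choose, Nat.descFactorial_eq_factorial_mul_choose,
    mul_assoc, mul_assoc] at key
  exact Nat.le_of_mul_le_mul_left key s.factorial_pos

/-- Choosing `s` elements from each of three blocks of size `n` chooses `3 s` out of `3 n`. -/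
theorem choose_pow_three_le (n s : ℕ) : n.choose s ^ 3 ≤ (3 * n).choose (3 * s) := by
  have step : ∀ a b k l : ℕ, a.choose k * b.choose l ≤ (a + b).choose (k + l) := by
    intro a b k l
    rw [Nat.add_choose_eq]
    exact Finset.single_le_sum (f := fun ij : ℕ × ℕ => a.choose ij.1 * b.choose ij.2)
      (fun _ _ => Nat.zero_le _) (a := (k, l)) (by simp)
  calc n.choose s ^ 3 = n.choose s * n.choose s * n.choose s := by ring
    _ ≤ (n + n).choose (s + s) * n.choose s := Nat.mul_le_mul_right _ (step _ _ _ _)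
    _ ≤ (n + n + n).choose (s + s + s) := step _ _ _ _
    _ = (3 * n).choose (3 * s) := by congr 1 <;> ring

/-- The denominator of `expectedBad` is at least `(4 t).choose s ^ 3`, and the two remaining factors
`(3 t).choose s / (4 t).choose s` and `(4 s).choose s / (4 t).choose s` are at most `(3 / 4) ^ s` and
`(s / t) ^ s ≤ s / t`. -/
theorem expectedBad_le {t s : ℕ} (hs : 1 ≤ s) (hst : s ≤ t) :
    expectedBad t s ≤ s * (3 / 4 : ℝ) ^ s / t := by
  have ht : (0 : ℝ) < t := by exact_mod_cast (by omega : 0 < t)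
  have hst' : (s : ℝ) ≤ t := by exact_mod_cast hst
  obtain ⟨X, hX⟩ : ∃ X : ℝ, X = ((4 * t).choose s : ℕ) := ⟨_, rfl⟩
  have hX0 : 0 < X := by
    rw [hX]
    exact_mod_cast Nat.choose_pos (show s ≤ 4 * t by omega)
  have h1 : ((3 * t).choose s : ℝ) ≤ X * (3 / 4) ^ s := by
    have h : ((3 * t).choose s : ℝ) * (4 * t) ^ s ≤ X * (3 * t) ^ s := by
      rw [hX]
      exact_mod_cast choose_mul_pow_le (show 3 * t ≤ 4 * t by omega) s
    rw [show (3 * t : ℝ) = 3 / 4 * (4 * t) by ring,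
      mul_pow (3 / 4 : ℝ) (4 * t), ← mul_assoc] at h
    exact le_of_mul_le_mul_right h (by positivity)
  have h2 : ((4 * s).choose (3 * s) : ℝ) ≤ X * (s / t) := by
    have h : ((4 * s).choose s : ℝ) * (4 * t) ^ s ≤ X * (4 * s) ^ s := by
      rw [hX]
      exact_mod_cast choose_mul_pow_le (show 4 * s ≤ 4 * t by omega) s
    rw [show (4 * s : ℝ) = s / t * (4 * t) by field_simp,
      mul_pow (s / t : ℝ) (4 * t), ← mul_assoc] at h
    rw [← Nat.choose_symm (show 3 * s ≤ 4 * s by omega), show 4 * s - 3 * s = s by omega]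
    refine (le_of_mul_le_mul_right h (by positivity)).trans ?_
    gcongr
    exact pow_le_of_le_one (by positivity) ((div_le_one ht).2 hst') (by omega)
  have h3 : X ^ 3 ≤ (12 * t).choose (3 * s) := by
    have := choose_pow_three_le (4 * t) s
    rw [show 3 * (4 * t) = 12 * t by ring] at this
    rw [hX]
    exact_mod_cast this
  calc expectedBad t s ≤ X * (X * (3 / 4) ^ s) * (X * (s / t)) / X ^ 3 := by
        unfold expectedBad
        rw [← hX]
        gcongr
    _ = s * (3 / 4 : ℝ) ^ s / t := by field_simp

theorem sum_expectedBad_lt_one {t : ℕ} (ht : 13 ≤ t) :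
    ∑ s ∈ Finset.Icc 1 t, expectedBad t s < 1 := by
  have ht' : (13 : ℝ) ≤ t := by exact_mod_cast ht
  have hgeom : HasSum (fun s : ℕ => (s : ℝ) * (3 / 4 : ℝ) ^ s) 12 := by
    have h : ‖(3 / 4 : ℝ)‖ < 1 := by norm_num
    have := hasSum_coe_mul_geometric_of_norm_lt_one h
    norm_num at this ⊢
    exact this
  calc ∑ s ∈ Finset.Icc 1 t, expectedBad t s
      ≤ ∑ s ∈ Finset.Icc 1 t, s * (3 / 4 : ℝ) ^ s / t := Finset.sum_le_sum fun s hs =>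
        expectedBad_le (Finset.mem_Icc.1 hs).1 (Finset.mem_Icc.1 hs).2
    _ = (∑ s ∈ Finset.Icc 1 t, s * (3 / 4 : ℝ) ^ s) / t := by rw [Finset.sum_div]
    _ ≤ 12 / t := by
        gcongr
        exact sum_le_hasSum _ (fun s _ => by positivity) hgeom
    _ < 1 := by
        rw [div_lt_one (by linarith)]
        linarith

/-- `(3, 4)`-biregular graphs in which every set of at most a quarter of the left vertices can be
matched into the right side. -/
theorem exists_expander {t : ℕ} (ht : 13 ≤ t) :
    ∃ N : Fin (4 * t) → Finset (Fin (3 * t)), (∀ v, (N v).card ≤ 3) ∧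
      (∀ w, (Finset.univ.filter fun v => w ∈ N v).card ≤ 4) ∧
      ∀ S : Finset (Fin (4 * t)), S.card ≤ t → S.card ≤ (S.biUnion N).card :=
  exists_expander_of_expectedBad (sum_expectedBad_lt_one ht)

/-! ### Moving sets through an expander -/

/-- `h` is weakly `ε`-modular and vanishes at `∅`, so it is additive on disjoint unions up to `ε`
per union taken. -/
theorem abs_biUnion_sub_sum_le {n : ℕ} {ε : ℝ} (hε : 0 ≤ ε) {h : Finset (Fin n) → ℝ}
    (h0 : h ∅ = 0) (hw : IsWeaklyModular ε h) {ι : Type*} [DecidableEq ι] (J : Finset ι)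
    (S : ι → Finset (Fin n)) (hS : ∀ a ∈ J, ∀ b ∈ J, a ≠ b → Disjoint (S a) (S b)) (k : ℕ)
    (hk : J.card ≤ k + 1) : |h (J.biUnion S) - ∑ a ∈ J, h (S a)| ≤ k * ε := by
  induction k generalizing J with
  | zero =>
    rcases J.eq_empty_or_nonempty with rfl | hne
    · simp [h0]
    · obtain ⟨a, rfl⟩ := Finset.card_eq_one.1 (le_antisymm hk hne.card_pos)
      simp
  | succ k ih =>
    rcases J.eq_empty_or_nonempty with rfl | ⟨a, ha⟩
    · simp only [Finset.biUnion_empty, h0, Finset.sum_empty, sub_zero, abs_zero]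
      positivity
    · have h1 := ih (J.erase a) (fun b hb c hc => hS b (Finset.mem_of_mem_erase hb) c
        (Finset.mem_of_mem_erase hc)) (by rw [Finset.card_erase_of_mem ha]; omega)
      have hd : Disjoint (S a) ((J.erase a).biUnion S) := by
        rw [Finset.disjoint_biUnion_right]
        intro b hb
        exact hS a ha b (Finset.mem_of_mem_erase hb) (Finset.ne_of_mem_erase hb).symm
      have h2 := hw _ _ hd
      rw [Finset.disjoint_iff_inter_eq_empty.1 hd, h0, ← Finset.biUnion_insert,
        Finset.insert_erase ha] at h2
      rw [← Finset.add_sum_erase J _ ha]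
      rw [abs_le] at h1 h2 ⊢
      push_cast
      constructor <;> linarith [h1.1, h1.2, h2.1, h2.2]

/-- Each item is moved from the sets `D v` containing it to right vertices, injectively and along
edges of the graph. This replaces the `4 t` sets `D v` by `3 t` sets, at the cost of the splittings
at the left vertices and the unions at the right vertices. -/
theorem sum_le_of_expander {n : ℕ} {ε B : ℝ} (hε : 0 ≤ ε) {h : Finset (Fin n) → ℝ}
    (h0 : h ∅ = 0) (hw : IsWeaklyModular ε h) (hB : ∀ S, h S ≤ B) {t : ℕ}
    (N : Fin (4 * t) → Finset (Fin (3 * t))) (hN : ∀ v, (N v).card ≤ 3)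
    (hN' : ∀ w, (Finset.univ.filter fun v => w ∈ N v).card ≤ 4)
    (hall : ∀ S : Finset (Fin (4 * t)), S.card ≤ t → S.card ≤ (S.biUnion N).card)
    (D : Fin (4 * t) → Finset (Fin n))
    (hD : ∀ i, (Finset.univ.filter fun v => i ∈ D v).card ≤ t) :
    ∑ v, h (D v) ≤ 3 * t * B + 17 * t * ε := by
  classical
  have hmatch : ∀ i : Fin n, ∃ φ : {v // i ∈ D v} → Fin (3 * t), Function.Injective φ ∧
      ∀ v, φ v ∈ N v.1 := by
    intro i
    refine (Finset.all_card_le_biUnion_card_iff_exists_injective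
      (fun v : {v // i ∈ D v} => N v.1)).1 fun S => ?_
    have h1 : (S.map (Function.Embedding.subtype _)).card ≤ t :=
      (Finset.card_le_card fun v hv => by
        obtain ⟨x, -, rfl⟩ := Finset.mem_map.1 hv
        simpa using x.2).trans (hD i)
    have h2 := hall _ h1
    rw [Finset.card_map] at h2
    refine h2.trans_eq ?_
    congr 1
    ext w
    simp
  choose φ hinj hφ using hmatch
  let S : Fin (4 * t) → Fin (3 * t) → Finset (Fin n) := fun v w =>
    Finset.univ.filter fun i => ∃ hi : i ∈ D v, φ i ⟨v, hi⟩ = w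
  let N' : Fin (3 * t) → Finset (Fin (4 * t)) := fun w => Finset.univ.filter fun v => w ∈ N v
  have hsplit : ∀ v, (N v).biUnion (S v) = D v := by
    intro v
    ext i
    simp only [S, Finset.mem_biUnion, Finset.mem_filter, Finset.mem_univ, true_and]
    constructor
    · rintro ⟨w, -, hi, -⟩
      exact hi
    · intro hi
      exact ⟨_, hφ i ⟨v, hi⟩, hi, rfl⟩
  have hleft : ∀ v, h (D v) ≤ ∑ w ∈ N v, h (S v w) + 2 * ε := by
    intro v
    have := abs_biUnion_sub_sum_le hε h0 hw (N v) (S v) (fun a _ b _ hab => by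
      rw [Finset.disjoint_left]
      intro i hi hj
      simp only [S, Finset.mem_filter, Finset.mem_univ, true_and] at hi hj
      obtain ⟨h1, h2⟩ := hi
      obtain ⟨h3, h4⟩ := hj
      exact hab (h2.symm.trans h4)) 2 (hN v)
    rw [hsplit v] at this
    have := (abs_le.1 this).2
    push_cast at this
    linarith
  have hright : ∀ w, ∑ v ∈ N' w, h (S v w) ≤ B + 3 * ε := by
    intro w
    have := abs_biUnion_sub_sum_le hε h0 hw (N' w) (fun v => S v w) (fun a _ b _ hab => by
      rw [Finset.disjoint_left]
      intro i hi hj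
      simp only [S, Finset.mem_filter, Finset.mem_univ, true_and] at hi hj
      obtain ⟨h1, h2⟩ := hi
      obtain ⟨h3, h4⟩ := hj
      exact hab (congrArg Subtype.val (hinj i (h2.trans h4.symm)))) 3 (hN' w)
    have := (abs_le.1 this).1
    have := hB ((N' w).biUnion fun v => S v w)
    push_cast at *
    linarith
  calc ∑ v, h (D v) ≤ ∑ v, (∑ w ∈ N v, h (S v w) + 2 * ε) := Finset.sum_le_sum fun v _ => hleft v
    _ = ∑ w, ∑ v ∈ N' w, h (S v w) + 4 * t * (2 * ε) := by
        rw [Finset.sum_add_distrib]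
        congr 1
        · apply Finset.sum_comm'
          simp [N']
        · simp
    _ ≤ ∑ w : Fin (3 * t), (B + 3 * ε) + 4 * t * (2 * ε) := by
        gcongr with w
        exact hright w
    _ = 3 * t * B + 17 * t * ε := by
        simp
        ring

/-- Limit form of `sum_le_of_expander` for a weighted family `D` in which every item has weight at
most `1 / 4`: the weights are rounded down to multiples of `1 / (4 t)`
and the free left vertices receive the empty set, where `h` vanishes. -/
theorem sum_weight_le {n : ℕ} {ε B : ℝ} (hε : 0 ≤ ε) {h : Finset (Fin n) → ℝ}
    (h0 : h ∅ = 0) (hw : IsWeaklyModular ε h) (hB : ∀ S, h S ≤ B)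
    {ι : Type*} [Fintype ι] (p : ι → ℝ) (hp : ∀ j, 0 ≤ p j) (hsum : ∑ j, p j = 1)
    (D : ι → Finset (Fin n))
    (hD : ∀ i, ∑ j ∈ Finset.univ.filter (fun j => i ∈ D j), p j ≤ 1 / 4) :
    ∑ j, p j * h (D j) ≤ 3 / 4 * B + 17 / 4 * ε := by
  classical
  let c : ℕ → ι → ℕ := fun t j => ⌊p j * ((4 * t : ℕ) : ℝ)⌋₊
  have hc : ∀ t j, (c t j : ℝ) ≤ p j * ((4 * t : ℕ) : ℝ) := fun t j =>
    Nat.floor_le (mul_nonneg (hp j) (Nat.cast_nonneg _))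
  have key : ∀ t ≥ 13, ∑ j, (c t j : ℝ) * h (D j) ≤ 3 * t * B + 17 * t * ε := by
    intro t ht
    obtain ⟨N, hN, hN', hall⟩ := exists_expander ht
    have hle : ∑ j, c t j ≤ 4 * t := by
      have : (∑ j, (c t j : ℝ)) ≤ ((4 * t : ℕ) : ℝ) := by
        calc (∑ j, (c t j : ℝ)) ≤ ∑ j, p j * ((4 * t : ℕ) : ℝ) :=
              Finset.sum_le_sum fun j _ => hc t j
          _ = _ := by rw [← Finset.sum_mul, hsum, one_mul]
      exact_mod_cast this
    let V := (Σ j, Fin (c t j)) ⊕ Fin (4 * t - ∑ j, c t j)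
    have hV : Fintype.card V = Fintype.card (Fin (4 * t)) := by
      simp only [V, Fintype.card_sum, Fintype.card_sigma, Fintype.card_fin]
      omega
    let e : V ≃ Fin (4 * t) := Fintype.equivOfCardEq hV
    let D' : V → Finset (Fin n) := Sum.elim (fun x => D x.1) fun _ => ∅
    have hfreq : ∀ i, (Finset.univ.filter fun v => i ∈ D' (e.symm v)).card ≤ t := by
      intro i
      have h1 : (Finset.univ.filter fun v => i ∈ D' (e.symm v)).card =
          ∑ v : V, if i ∈ D' v then 1 else 0 := by
        rw [Finset.card_filter]
        exact Equiv.sum_comp e.symm fun v => if i ∈ D' v then 1 else 0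
      have h2 : (∑ v : V, if i ∈ D' v then 1 else 0) =
          ∑ j ∈ Finset.univ.filter (fun j => i ∈ D j), c t j := by
        have hl : ∀ j, (∑ y : Fin (c t j), if i ∈ D' (Sum.inl ⟨j, y⟩) then 1 else 0) =
            if i ∈ D j then c t j else 0 := by
          intro j
          by_cases hj : i ∈ D j
          · have : ∀ y : Fin (c t j), i ∈ D' (Sum.inl ⟨j, y⟩) := fun _ => hj
            simp [this, hj]
          · have : ∀ y : Fin (c t j), i ∉ D' (Sum.inl ⟨j, y⟩) := fun _ => hj
            simp [this, hj]
        have hr : ∀ x, i ∉ D' (Sum.inr x) := fun x => Finset.notMem_empty i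
        rw [Fintype.sum_sum_type, Fintype.sum_sigma, Finset.sum_filter]
        simp [hl, hr]
      rw [h1, h2]
      have : (∑ j ∈ Finset.univ.filter (fun j => i ∈ D j), (c t j : ℝ)) ≤ t := by
        calc _ ≤ ∑ j ∈ Finset.univ.filter (fun j => i ∈ D j), p j * ((4 * t : ℕ) : ℝ) :=
              Finset.sum_le_sum fun j _ => hc t j
          _ ≤ 1 / 4 * ((4 * t : ℕ) : ℝ) := by
              rw [← Finset.sum_mul]
              exact mul_le_mul_of_nonneg_right (hD i) (Nat.cast_nonneg _)
          _ = t := by push_cast; ring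
      exact_mod_cast this
    have h3 := sum_le_of_expander hε h0 hw hB N hN hN' hall (fun v => D' (e.symm v)) hfreq
    rw [Equiv.sum_comp e.symm fun v => h (D' v), Fintype.sum_sum_type, Fintype.sum_sigma] at h3
    simpa [D', h0] using h3
  have hcast : Filter.Tendsto (fun t : ℕ => ((4 * t : ℕ) : ℝ)) Filter.atTop Filter.atTop :=
    tendsto_natCast_atTop_atTop.comp
      (Filter.tendsto_id.const_mul_atTop' (by norm_num : 0 < 4))
  have hlim : Filter.Tendsto (fun t : ℕ => ∑ j, ((c t j : ℝ) / ((4 * t : ℕ) : ℝ)) * h (D j))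
      Filter.atTop (nhds (∑ j, p j * h (D j))) := by
    refine tendsto_finsetSum _ fun j _ => Filter.Tendsto.mul_const _ ?_
    exact (tendsto_nat_floor_mul_div_atTop (hp j)).comp hcast
  refine le_of_tendsto hlim ?_
  filter_upwards [Filter.eventually_ge_atTop 13, Filter.eventually_gt_atTop 0] with t ht ht0
  have hpos : (0 : ℝ) < ((4 * t : ℕ) : ℝ) := by exact_mod_cast (by omega : 0 < 4 * t)
  have := key t ht
  rw [show ∑ j, ((c t j : ℝ) / ((4 * t : ℕ) : ℝ)) * h (D j) =
    (∑ j, (c t j : ℝ) * h (D j)) / ((4 * t : ℕ) : ℝ) by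
      rw [Finset.sum_div]; exact Finset.sum_congr rfl fun j _ => by ring, div_le_iff₀ hpos]
  push_cast
  linarith

/-! ### Closest linear functions and duality -/

/-- The linear set functions, as a subspace. -/
def linearSubmodule (n : ℕ) : Submodule ℝ (Finset (Fin n) → ℝ) where
  carrier := {l | IsLinear l}
  zero_mem' := ⟨0, 0, fun S => by simp⟩
  add_mem' := by
    rintro a b ⟨a₀, a, ha⟩ ⟨b₀, b, hb⟩
    refine ⟨a₀ + b₀, a + b, fun S => ?_⟩
    simp only [Pi.add_apply, ha, hb, Finset.sum_add_distrib]
    ring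
  smul_mem' := by
    rintro r a ⟨a₀, a, ha⟩
    refine ⟨r * a₀, r • a, fun S => ?_⟩
    simp only [Pi.smul_apply, ha, smul_eq_mul, ← Finset.mul_sum]
    ring

theorem mem_linearSubmodule {n : ℕ} {l : Finset (Fin n) → ℝ} :
    l ∈ linearSubmodule n ↔ IsLinear l := Iff.rfl

/-- The distance of `f` to the linear set functions, in the maximum norm. -/
noncomputable def linDist {n : ℕ} (f : Finset (Fin n) → ℝ) : ℝ :=
  Metric.infDist f (linearSubmodule n : Set (Finset (Fin n) → ℝ))

theorem linDist_nonneg {n : ℕ} (f : Finset (Fin n) → ℝ) : 0 ≤ linDist f := Metric.infDist_nonneg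

theorem exists_isLinear_isClose {n : ℕ} (f : Finset (Fin n) → ℝ) :
    ∃ l, IsLinear l ∧ IsClose (linDist f) f l := by
  obtain ⟨l, hl, h⟩ := (linearSubmodule n).closed_of_finiteDimensional.exists_infDist_eq_dist
    ⟨0, (linearSubmodule n).zero_mem⟩ f
  refine ⟨l, hl, fun S => ?_⟩
  rw [linDist, h, ← Real.dist_eq]
  exact dist_le_pi_dist f l S

theorem isDeltaLinear_iff {n : ℕ} {Δ : ℝ} {f : Finset (Fin n) → ℝ} :
    IsDeltaLinear Δ f ↔ linDist f ≤ Δ := by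
  constructor
  · rintro ⟨l, hl, h⟩
    refine (Metric.infDist_le_dist_of_mem (mem_linearSubmodule.2 hl)).trans ?_
    exact (dist_pi_le_iff ((abs_nonneg _).trans (h ∅))).2 fun S => by
      rw [Real.dist_eq]; exact h S
  · intro h
    obtain ⟨l, hl, hc⟩ := exists_isLinear_isClose f
    exact ⟨l, hl, fun S => (hc S).trans h⟩

theorem IsLinear.modular {n : ℕ} {l : Finset (Fin n) → ℝ} (hl : IsLinear l)
    (S T : Finset (Fin n)) : l S + l T = l (S ∪ T) + l (S ∩ T) := by
  obtain ⟨c₀, c, h⟩ := hl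
  rw [h, h, h, h]
  linarith [Finset.sum_union_inter (s₁ := S) (s₂ := T) (f := c)]

theorem IsWeaklyModular.sub_isLinear {n : ℕ} {ε : ℝ} {f l : Finset (Fin n) → ℝ}
    (hf : IsWeaklyModular ε f) (hl : IsLinear l) : IsWeaklyModular ε fun S => f S - l S := by
  intro S T h
  have := hf S T h
  rwa [show f S + f T - f (S ∪ T) - f (S ∩ T) = (f S - l S) + (f T - l T) -
    (f (S ∪ T) - l (S ∪ T)) - (f (S ∩ T) - l (S ∩ T)) by linarith [hl.modular S T]] at this

theorem IsWeaklyModular.neg {n : ℕ} {ε : ℝ} {f : Finset (Fin n) → ℝ}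
    (hf : IsWeaklyModular ε f) : IsWeaklyModular ε fun S => -f S := by
  intro S T h
  have := hf S T h
  rwa [← abs_neg, show -(f S + f T - f (S ∪ T) - f (S ∩ T)) =
    -f S + -f T - -f (S ∪ T) - -f (S ∩ T) by ring] at this

theorem IsWeaklyModular.smul {n : ℕ} {ε : ℝ} {f : Finset (Fin n) → ℝ}
    (hf : IsWeaklyModular ε f) {r : ℝ} (hr : 0 ≤ r) :
    IsWeaklyModular (r * ε) fun S => r * f S := by
  intro S T h
  have := hf S T h
  rw [show r * f S + r * f T - r * f (S ∪ T) - r * f (S ∩ T) =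
    r * (f S + f T - f (S ∪ T) - f (S ∩ T)) by ring, abs_mul, abs_of_nonneg hr]
  gcongr

theorem IsDeltaLinear.smul {n : ℕ} {Δ : ℝ} {f : Finset (Fin n) → ℝ}
    (hf : IsDeltaLinear Δ f) {r : ℝ} (hr : 0 ≤ r) :
    IsDeltaLinear (r * Δ) fun S => r * f S := by
  obtain ⟨l, hl, h⟩ := hf
  refine ⟨r • l, (linearSubmodule n).smul_mem r hl, fun S => ?_⟩
  rw [Pi.smul_apply, smul_eq_mul, ← mul_sub, abs_mul, abs_of_nonneg hr]
  have := h S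
  gcongr

/-- Duality for the distance to linear functions: there are finite measures `p`, `q` on sets of
equal mass at most `1 / 2`, with the same weight at each item, whose integrals of `f` differ by
the distance of `f` to the linear functions. -/
theorem exists_dual_weights {n : ℕ} (f : Finset (Fin n) → ℝ) :
    ∃ p q : Finset (Fin n) → ℝ, (∀ S, 0 ≤ p S) ∧ (∀ S, 0 ≤ q S) ∧
      ∑ S, p S = ∑ S, q S ∧ ∑ S, p S ≤ 1 / 2 ∧
      (∀ i, ∑ S ∈ Finset.univ.filter (fun S => i ∈ S), p S =
        ∑ S ∈ Finset.univ.filter (fun S => i ∈ S), q S) ∧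
      (∀ l, IsLinear l → ∑ S, p S * (f S - l S) - ∑ S, q S * (f S - l S) = linDist f) := by
  classical
  let L := linearSubmodule n
  have : IsClosed (L : Set (Finset (Fin n) → ℝ)) := L.closed_of_finiteDimensional
  obtain ⟨φ, hφ, hφf⟩ := exists_dual_vector'' ℝ (L.mkQ f)
  let ψ : (Finset (Fin n) → ℝ) →ₗ[ℝ] ℝ := φ.toLinearMap ∘ₗ L.mkQ
  have hψL : ∀ l, IsLinear l → ψ l = 0 := by
    intro l hl
    have : L.mkQ l = 0 := (Submodule.Quotient.mk_eq_zero L).2 hl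
    simp only [ψ, LinearMap.comp_apply, this, map_zero]
  have hψf : ψ f = linDist f := by
    have h1 : ψ f = ‖L.mkQ f‖ := by simpa [ψ] using hφf
    rw [h1, linDist]
    exact QuotientAddGroup.norm_mk (S := L.toAddSubgroup) f
  have hψle : ∀ x : Finset (Fin n) → ℝ, ψ x ≤ ‖x‖ := by
    intro x
    calc ψ x ≤ ‖φ (L.mkQ x)‖ := le_abs_self _
      _ ≤ ‖φ‖ * ‖L.mkQ x‖ := φ.le_opNorm _
      _ ≤ 1 * ‖x‖ := by
          gcongr
          exact QuotientAddGroup.norm_mk_le_norm (S := L.toAddSubgroup)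
      _ = ‖x‖ := one_mul _
  let c : Finset (Fin n) → ℝ := fun S => ψ fun T => if S = T then 1 else 0
  have hψ : ∀ x, ψ x = ∑ S, x S * c S := fun x => by
    simpa only [smul_eq_mul] using LinearMap.pi_apply_eq_sum_univ ψ x
  have habs : ∑ S, |c S| ≤ 1 := by
    -- Test the functional on the sign vector, which has norm at most `1`.
    have h1 : ψ (fun S => SignType.sign (c S)) = ∑ S, |c S| := by
      rw [hψ]
      exact Finset.sum_congr rfl fun S _ => by rw [mul_comm, self_mul_sign]
    rw [← h1]
    refine (hψle _).trans ((pi_norm_le_iff_of_nonneg zero_le_one).2 fun S => ?_)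
    rcases lt_trichotomy (c S) 0 with h | h | h <;> simp [h]
  have hconst : ∑ S, c S = 0 := by
    have := hψL (fun _ => 1) ⟨1, 0, fun S => by simp⟩
    simpa [hψ] using this
  have hitem : ∀ i, ∑ S ∈ Finset.univ.filter (fun S => i ∈ S), c S = 0 := by
    intro i
    have := hψL (fun S => if i ∈ S then 1 else 0) ⟨0, Pi.single i 1, fun S => by
      simp⟩
    rw [hψ] at this
    simpa [Finset.sum_filter] using this
  refine ⟨fun S => (|c S| + c S) / 2, fun S => (|c S| - c S) / 2, fun S => ?_, fun S => ?_, ?_, ?_,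
    fun i => ?_, fun l hl => ?_⟩
  · linarith [neg_abs_le (c S)]
  · linarith [le_abs_self (c S)]
  · rw [← Finset.sum_div, ← Finset.sum_div, Finset.sum_add_distrib, Finset.sum_sub_distrib, hconst]
    ring
  · rw [← Finset.sum_div, Finset.sum_add_distrib, hconst]
    linarith
  · rw [← Finset.sum_div, ← Finset.sum_div, Finset.sum_add_distrib, Finset.sum_sub_distrib, hitem]
    ring
  · have h1 : ψ (f - l) = linDist f := by rw [map_sub, hψL l hl, hψf, sub_zero]
    rw [← h1, hψ, ← Finset.sum_sub_distrib]
    exact Finset.sum_congr rfl fun S _ => by rw [Pi.sub_apply]; ring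

/-- Averaging over pairs of a positive set `P` and a negative set `N`: the sets `P \ N` contain
each item with weight `x (1 - x) ≤ 1 / 4`, and so do the sets `N \ P`, which lets both families be
pushed through the expander; removing `P ∩ N` costs only two applications of weak modularity. -/
theorem linDist_le {n : ℕ} {ε : ℝ} (hε : 0 ≤ ε) {f : Finset (Fin n) → ℝ}
    (hf : IsWeaklyModular ε f) : linDist f ≤ 21 * ε := by
  classical
  obtain ⟨l, hl, hclose⟩ := exists_isLinear_isClose f
  obtain ⟨p, q, hp, hq, hpq, hle, hmarg, hval⟩ := exists_dual_weights f
  have hval := hval l hl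
  set M := linDist f with hM
  set τ := ∑ S, p S with hτ
  let g : Finset (Fin n) → ℝ := fun S => f S - l S
  have hg : IsWeaklyModular ε g := hf.sub_isLinear hl
  have hgM : ∀ S, |g S| ≤ M := hclose
  have hM0 : 0 ≤ M := linDist_nonneg f
  rcases hM0.eq_or_lt with h0 | hMpos
  · rw [← h0]; positivity
  -- With `τ = 0` both integrals vanish, so that the distance would be `0`.
  have hτ0 : 0 < τ := by
    refine lt_of_le_of_ne (Finset.sum_nonneg fun S _ => hp S) fun h => ?_
    have hp0 : ∀ S, p S = 0 := fun S =>
      (Finset.sum_eq_zero_iff_of_nonneg fun S _ => hp S).1 h.symm S (Finset.mem_univ S)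
    have hq0 : ∀ S, q S = 0 := fun S =>
      (Finset.sum_eq_zero_iff_of_nonneg fun S _ => hq S).1 (hpq ▸ h.symm) S (Finset.mem_univ S)
    simp only [hp0, hq0, zero_mul, Finset.sum_const_zero, sub_zero] at hval
    exact hMpos.ne hval
  -- After normalization the averages of `g` differ by `M / τ ≥ 2 M`.
  let p' : Finset (Fin n) → ℝ := fun S => p S / τ
  let q' : Finset (Fin n) → ℝ := fun S => q S / τ
  have hp'0 : ∀ S, 0 ≤ p' S := fun S => div_nonneg (hp S) hτ0.le
  have hq'0 : ∀ S, 0 ≤ q' S := fun S => div_nonneg (hq S) hτ0.le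
  have hp'1 : ∑ S, p' S = 1 := by rw [← Finset.sum_div, ← hτ, div_self hτ0.ne']
  have hq'1 : ∑ S, q' S = 1 := by rw [← Finset.sum_div, ← hpq, div_self hτ0.ne']
  have hval' : 2 * M ≤ ∑ S, p' S * g S - ∑ S, q' S * g S := by
    have h1 : ∑ S, p' S * g S - ∑ S, q' S * g S = M / τ := by
      rw [← hval, sub_div, Finset.sum_div, Finset.sum_div]
      congr 1 <;> exact Finset.sum_congr rfl fun S _ => by ring
    rw [h1, le_div_iff₀ hτ0]
    nlinarith
  let w : Finset (Fin n) × Finset (Fin n) → ℝ := fun x => p' x.1 * q' x.2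
  have hw0 : ∀ x, 0 ≤ w x := fun x => mul_nonneg (hp'0 _) (hq'0 _)
  have hprod : ∀ (a b : Finset (Fin n) → ℝ), ∑ x : Finset (Fin n) × Finset (Fin n), a x.1 * b x.2 =
      (∑ S, a S) * ∑ S, b S := by
    intro a b
    rw [Fintype.sum_prod_type, Finset.sum_mul_sum]
  have hw1 : ∑ x, w x = 1 := by rw [hprod, hp'1, hq'1, one_mul]
  have hitem : ∀ i, ∃ r : ℝ, (∑ S, if i ∈ S then p' S else 0) = r ∧
      (∑ S, if i ∈ S then q' S else 0) = r ∧ (∑ S, if i ∈ S then 0 else p' S) = 1 - r ∧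
      (∑ S, if i ∈ S then 0 else q' S) = 1 - r := by
    intro i
    have h1 : ∀ a : Finset (Fin n) → ℝ, (∑ S, if i ∈ S then a S else 0) +
        (∑ S, if i ∈ S then 0 else a S) = ∑ S, a S := by
      intro a
      rw [← Finset.sum_add_distrib]
      exact Finset.sum_congr rfl fun S _ => by split_ifs <;> simp
    have h2 : (∑ S, if i ∈ S then q' S else 0) = ∑ S, if i ∈ S then p' S else 0 := by
      rw [← Finset.sum_filter, ← Finset.sum_filter, ← Finset.sum_div, ← Finset.sum_div, hmarg]
    refine ⟨_, rfl, h2, ?_, ?_⟩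
    · linarith [h1 p']
    · linarith [h1 q']
  have hquarter : ∀ r : ℝ, r * (1 - r) ≤ 1 / 4 := fun r => by nlinarith [sq_nonneg (r - 1 / 2)]
  let h : Finset (Fin n) → ℝ := fun S => g S - g ∅
  have hh : IsWeaklyModular ε h := hg.sub_isLinear ⟨g ∅, 0, fun S => by simp⟩
  have hh0 : h ∅ = 0 := sub_self _
  -- The `g ∅` terms in the two upper bounds `M - g ∅` and `M + g ∅` cancel in the sum.
  have hup := sum_weight_le hε hh0 hh (B := M - g ∅)
    (fun S => by have := (abs_le.1 (hgM S)).2; simp only [h]; linarith) w hw0 hw1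
    (fun x => x.1 \ x.2) fun i => by
      obtain ⟨r, hr1, -, -, hr4⟩ := hitem i
      rw [Finset.sum_filter]
      refine le_of_eq_of_le ?_ (hquarter r)
      rw [← hr4]
      rw [← hr1]
      rw [← hprod]
      refine Finset.sum_congr rfl fun x _ => ?_
      by_cases hi1 : i ∈ x.1 <;> by_cases hi2 : i ∈ x.2 <;> simp [hi1, hi2, w]
  have hdown := sum_weight_le hε (h := fun S => -h S) (by simp [hh0]) hh.neg (B := M + g ∅)
    (fun S => by have := (abs_le.1 (hgM S)).1; simp only [h]; linarith) w hw0 hw1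
    (fun x => x.2 \ x.1) fun i => by
      obtain ⟨r, -, hr2, hr3, -⟩ := hitem i
      rw [Finset.sum_filter]
      refine le_of_eq_of_le ?_ (hquarter r)
      rw [mul_comm, ← hr3]
      rw [← hr2]
      rw [← hprod]
      refine Finset.sum_congr rfl fun x _ => ?_
      by_cases hi1 : i ∈ x.1 <;> by_cases hi2 : i ∈ x.2 <;> simp [hi1, hi2, w]
  -- `S \ T` and `T \ S` arise by removing the same set `S ∩ T`, which cancels in a difference.
  have hcut : ∀ S T : Finset (Fin n), |h S - h (S \ T) - h (S ∩ T)| ≤ ε := by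
    intro S T
    have hd : Disjoint (S \ T) (S ∩ T) :=
      Finset.disjoint_left.2 fun i h1 h2 => (Finset.mem_sdiff.1 h1).2 (Finset.mem_inter.1 h2).2
    have := hh _ _ hd
    rw [Finset.disjoint_iff_inter_eq_empty.1 hd, hh0, Finset.sdiff_union_inter, ← abs_neg] at this
    rwa [show h S - h (S \ T) - h (S ∩ T) = -(h (S \ T) + h (S ∩ T) - h S - 0) by ring]
  have hpair : ∀ x : Finset (Fin n) × Finset (Fin n),
      g x.1 - g x.2 ≤ h (x.1 \ x.2) + -h (x.2 \ x.1) + 2 * ε := by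
    intro x
    have h1 := (abs_le.1 (hcut x.1 x.2)).2
    have h2 := (abs_le.1 (hcut x.2 x.1)).1
    rw [Finset.inter_comm] at h2
    simp only [h] at *
    linarith
  have htotal : ∑ x, w x * (g x.1 - g x.2) = ∑ S, p' S * g S - ∑ S, q' S * g S := by
    have h1 : ∑ x : Finset (Fin n) × Finset (Fin n), w x * g x.1 = ∑ S, p' S * g S := by
      have := hprod (fun S => p' S * g S) q'
      rw [hq'1, mul_one] at this
      rw [← this]
      exact Finset.sum_congr rfl fun x _ => by simp only [w]; ring
    have h2 : ∑ x : Finset (Fin n) × Finset (Fin n), w x * g x.2 = ∑ S, q' S * g S := by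
      have := hprod p' (fun S => q' S * g S)
      rw [hp'1, one_mul] at this
      rw [← this]
      exact Finset.sum_congr rfl fun x _ => by simp only [w]; ring
    simp only [mul_sub, Finset.sum_sub_distrib, h1, h2]
  have hbound : ∑ x, w x * (g x.1 - g x.2) ≤
      ∑ x, w x * h (x.1 \ x.2) + ∑ x, w x * -h (x.2 \ x.1) + 2 * ε := by
    calc ∑ x, w x * (g x.1 - g x.2)
        ≤ ∑ x, w x * (h (x.1 \ x.2) + -h (x.2 \ x.1) + 2 * ε) :=
          Finset.sum_le_sum fun x _ => mul_le_mul_of_nonneg_left (hpair x) (hw0 x)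
      _ = _ := by
          simp only [mul_add, Finset.sum_add_distrib]
          rw [← Finset.sum_mul, hw1, one_mul]
  linarith

theorem isDeltaLinear_of_isWeaklyModular {n : ℕ} {ε : ℝ} (hε : 0 ≤ ε) {f : Finset (Fin n) → ℝ}
    (hf : IsWeaklyModular ε f) : IsDeltaLinear (21 * ε) f :=
  isDeltaLinear_iff.2 (linDist_le hε hf)

/-! ### The weak Kalton constant -/

/-- The infimum of the admissible constants is attained, because the distance to the linear
functions is; by scaling it is sharp for every `ε > 0`. -/
theorem exists_isWeakKaltonConstant : ∃ K, IsWeakKaltonConstant K := by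
  let A : Set ℝ := {K | 0 ≤ K ∧ ∀ (n : ℕ) (ε : ℝ), 0 ≤ ε → ∀ f : Finset (Fin n) → ℝ,
    IsWeaklyModular ε f → IsDeltaLinear (K * ε) f}
  have hA : A.Nonempty :=
    ⟨21, by norm_num, fun n ε hε f hf => isDeltaLinear_of_isWeaklyModular hε hf⟩
  have hbdd : BddBelow A := ⟨0, fun K hK => hK.1⟩
  have hupper : ∀ (n : ℕ) (ε : ℝ), 0 ≤ ε → ∀ f : Finset (Fin n) → ℝ,
      IsWeaklyModular ε f → IsDeltaLinear (sInf A * ε) f := by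
    intro n ε hε f hf
    rw [isDeltaLinear_iff]
    rcases hε.eq_or_lt with rfl | hpos
    · simpa using linDist_le le_rfl hf
    · rw [← div_le_iff₀ hpos]
      refine le_csInf hA fun K hK => ?_
      rw [div_le_iff₀ hpos]
      exact isDeltaLinear_iff.1 (hK.2 n ε hε f hf)
  refine ⟨sInf A, le_csInf hA fun K hK => hK.1, hupper, fun κ hκ ε hε => ?_⟩
  rcases lt_or_ge κ 0 with hneg | hnonneg
  -- No function is `Δ`-linear with `Δ < 0`, so the zero function over no items is a witness.
  · refine ⟨0, 0, fun S T _ => by simpa using hε.le, fun h => ?_⟩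
    have := (linDist_nonneg _).trans (isDeltaLinear_iff.1 h)
    nlinarith
  -- A failure of `κ` at some `δ` rescales to `ε`; at `δ = 0` there is none.
  · have hκA : κ ∉ A := fun h => not_lt_of_ge (csInf_le hbdd h) hκ
    simp only [A, Set.mem_ofPred_eq, not_and] at hκA
    have h2 := hκA hnonneg
    push Not at h2
    obtain ⟨n, δ, hδ, f, hf, hnot⟩ := h2
    rcases hδ.eq_or_lt with rfl | hpos
    · refine absurd (isDeltaLinear_of_isWeaklyModular le_rfl hf) ?_
      simpa using hnot
    · refine ⟨n, fun S => ε / δ * f S, ?_, fun h => hnot ?_⟩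
      · have := hf.smul (r := ε / δ) (by positivity)
        rwa [div_mul_cancel₀ _ hpos.ne'] at this
      · have := h.smul (r := δ / ε) (by positivity)
        have e1 : (fun S => δ / ε * (ε / δ * f S)) = f := by
          funext S
          field_simp
        have e2 : δ / ε * (κ * ε) = κ * δ := by field_simp
        rwa [e1, e2] at this

theorem IsWeakKaltonConstant.le {K K' : ℝ} (h : IsWeakKaltonConstant K)
    (hK' : ∀ (n : ℕ) (f : Finset (Fin n) → ℝ), IsWeaklyModular 1 f → IsDeltaLinear K' f) :
    K ≤ K' := by
  by_contra! hlt
  obtain ⟨n, f, hf, hnot⟩ := h.sharp K' hlt 1 one_pos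
  rw [mul_one] at hnot
  exact hnot (hK' n f hf)

theorem existsUnique_isWeakKaltonConstant : ∃! K, IsWeakKaltonConstant K := by
  obtain ⟨K, hK⟩ := exists_isWeakKaltonConstant
  refine ⟨K, hK, fun K' hK' => le_antisymm (hK'.le fun n f hf => ?_) (hK.le fun n f hf => ?_)⟩
  · simpa using hK.upper n 1 zero_le_one f hf
  · simpa using hK'.upper n 1 zero_le_one f hf

/-! ### A function of value `3` on a family of sets -/

section Family

variable {n g : ℕ} (P : Fin g → Finset (Fin n))

/-- The sets of positive value: they lie below some `P j` but below no `(P k)ᶜ`, or above some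
`P j` but above no `(P k)ᶜ`. -/
def IsPositive (S : Finset (Fin n)) : Prop :=
  ((∃ j, S ⊆ P j) ∧ ∀ k, ¬ S ⊆ (P k)ᶜ) ∨ ((∃ j, P j ⊆ S) ∧ ∀ k, ¬ (P k)ᶜ ⊆ S)

open Classical in
/-- The positive part of `familyFn`. -/
noncomputable def familyPos (S : Finset (Fin n)) : ℤ :=
  if ∃ j, S = P j then 3 else if IsPositive P S then 1 else 0

/-- The antisymmetric function with values `3` on the sets `P j` and `1` on the other positive
sets. -/
noncomputable def familyFn (S : Finset (Fin n)) : ℤ := familyPos P S - familyPos P Sᶜ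

theorem familyFn_compl (S : Finset (Fin n)) : familyFn P Sᶜ = -familyFn P S := by
  simp [familyFn]

theorem isPositive_compl_family (S : Finset (Fin n)) :
    IsPositive (fun j => (P j)ᶜ) S ↔ IsPositive P Sᶜ := by
  unfold IsPositive
  have h1 : ∀ j, S ⊆ (P j)ᶜ ↔ P j ⊆ Sᶜ := fun j => le_compl_iff_le_compl
  have h2 : ∀ j, (P j)ᶜ ⊆ S ↔ Sᶜ ⊆ P j := fun j => compl_le_iff_compl_le
  simp only [compl_compl, Finset.compl_subset_compl, h1, h2]
  tauto

variable {P} in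
theorem familyPos_congr {m h : ℕ} {P' : Fin h → Finset (Fin m)} {S : Finset (Fin n)}
    {S' : Finset (Fin m)} (h1 : (∃ j, S = P j) ↔ ∃ j, S' = P' j)
    (h2 : IsPositive P S ↔ IsPositive P' S') : familyPos P S = familyPos P' S' := by
  unfold familyPos
  split_ifs <;> tauto

theorem familyFn_compl_family (S : Finset (Fin n)) :
    familyFn (fun j => (P j)ᶜ) S = -familyFn P S := by
  have h : ∀ S, familyPos (fun j => (P j)ᶜ) S = familyPos P Sᶜ := by
    refine fun S => familyPos_congr (exists_congr fun j => ?_) (isPositive_compl_family P S)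
    rw [eq_compl_comm, eq_comm]
  unfold familyFn
  rw [h, h]
  simp

theorem familyFn_reindex (σ : Equiv.Perm (Fin g)) (S : Finset (Fin n)) :
    familyFn (fun j => P (σ j)) S = familyFn P S := by
  have h : ∀ S, familyPos (fun j => P (σ j)) S = familyPos P S := by
    refine fun S => familyPos_congr (σ.surjective.exists (p := fun j => S = P j)).symm ?_
    unfold IsPositive
    rw [σ.surjective.exists (p := fun j => S ⊆ P j),
      σ.surjective.exists (p := fun j => P j ⊆ S), σ.surjective.forall (p := fun j => ¬ S ⊆ (P j)ᶜ),
      σ.surjective.forall (p := fun j => ¬ (P j)ᶜ ⊆ S)]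
  unfold familyFn
  rw [h, h]

/-- The preimage of a set of items under a permutation of the items. -/
def permPreimage (π : Equiv.Perm (Fin n)) (S : Finset (Fin n)) : Finset (Fin n) :=
  S.map π.symm.toEmbedding

@[simp]
theorem mem_permPreimage (π : Equiv.Perm (Fin n)) (S : Finset (Fin n)) (i : Fin n) :
    i ∈ permPreimage π S ↔ π i ∈ S := by
  simp [permPreimage]

theorem permPreimage_compl (π : Equiv.Perm (Fin n)) (S : Finset (Fin n)) :
    permPreimage π Sᶜ = (permPreimage π S)ᶜ := by
  ext i; simp

theorem permPreimage_subset (π : Equiv.Perm (Fin n)) (S T : Finset (Fin n)) :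
    permPreimage π S ⊆ permPreimage π T ↔ S ⊆ T :=
  Finset.map_subset_map

theorem familyFn_permPreimage (π : Equiv.Perm (Fin n)) (S : Finset (Fin n)) :
    familyFn (fun j => permPreimage π (P j)) (permPreimage π S) = familyFn P S := by
  have h : ∀ S, familyPos (fun j => permPreimage π (P j)) (permPreimage π S) = familyPos P S := by
    refine fun S => familyPos_congr (exists_congr fun j => Finset.map_inj) ?_
    simp only [IsPositive, ← permPreimage_compl, permPreimage_subset]
  unfold familyFn
  rw [← permPreimage_compl, h, h]

variable {P}

theorem familyPos_nonneg (S : Finset (Fin n)) : 0 ≤ familyPos P S := by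
  unfold familyPos
  split_ifs <;> norm_num

theorem familyPos_le_three (S : Finset (Fin n)) : familyPos P S ≤ 3 := by
  unfold familyPos
  split_ifs <;> norm_num

theorem familyFn_le_three (S : Finset (Fin n)) : familyFn P S ≤ 3 := by
  have h1 := familyPos_le_three (P := P) S
  have h2 := familyPos_nonneg (P := P) Sᶜ
  unfold familyFn
  linarith

theorem familyFn_le_one {S : Finset (Fin n)} (h : ∀ j, S ≠ P j) : familyFn P S ≤ 1 := by
  have h1 : familyPos P S ≤ 1 := by
    unfold familyPos
    split_ifs with h1 h2
    · exact absurd h1 (by simpa using h)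
    all_goals norm_num
  have h2 := familyPos_nonneg (P := P) Sᶜ
  unfold familyFn
  linarith

/-- Any three members of the family have a common item. -/
def ThreeMeet (P : Fin g → Finset (Fin n)) : Prop :=
  ∀ j k l, ∃ i, i ∈ P j ∧ i ∈ P k ∧ i ∈ P l

theorem isPositive_apply (hmeet : ThreeMeet P) (j : Fin g) : IsPositive P (P j) := by
  refine Or.inl ⟨⟨j, subset_rfl⟩, fun k hk => ?_⟩
  obtain ⟨i, hj, hk', -⟩ := hmeet j k k
  exact Finset.mem_compl.1 (hk hj) hk'

theorem familyPos_eq_zero (hmeet : ThreeMeet P) {S : Finset (Fin n)} (h : ¬ IsPositive P S) :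
    familyPos P S = 0 := by
  unfold familyPos
  rw [if_neg, if_neg h]
  rintro ⟨j, rfl⟩
  exact h (isPositive_apply hmeet j)

theorem not_isPositive_compl (hmeet : ThreeMeet P) (hmiss : ThreeMeet fun j => (P j)ᶜ)
    {S : Finset (Fin n)} (h : IsPositive P S) : ¬ IsPositive P Sᶜ := by
  rintro (⟨⟨l, hl⟩, hl'⟩ | ⟨⟨l, hl⟩, hl'⟩) <;> rcases h with (⟨⟨j, hj⟩, hj'⟩ | ⟨⟨j, hj⟩, hj'⟩)
  · obtain ⟨i, h1, h2, -⟩ := hmiss j l l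
    rw [Finset.mem_compl] at h1 h2
    by_cases hi : i ∈ S
    · exact h1 (hj hi)
    · exact h2 (hl (Finset.mem_compl.2 hi))
  · exact hj' l (compl_le_iff_compl_le.1 hl)
  · exact hj' l (le_compl_iff_le_compl.1 hl)
  · obtain ⟨i, h1, h2, -⟩ := hmeet j l l
    exact Finset.mem_compl.1 (hl h2) (hj h1)

theorem familyFn_nonpos (hmeet : ThreeMeet P) {S : Finset (Fin n)} (h : ¬ IsPositive P S) :
    familyFn P S ≤ 0 := by
  have h2 := familyPos_nonneg (P := P) Sᶜ
  unfold familyFn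
  rw [familyPos_eq_zero hmeet h]
  linarith

theorem familyFn_le_neg_one (hmeet : ThreeMeet P) (hmiss : ThreeMeet fun j => (P j)ᶜ)
    {S : Finset (Fin n)} (h : IsPositive P Sᶜ) : familyFn P S ≤ -1 := by
  have h1 : familyPos P S = 0 := by
    refine familyPos_eq_zero hmeet ?_
    have := not_isPositive_compl hmeet hmiss h
    rwa [compl_compl] at this
  have h2 : 1 ≤ familyPos P Sᶜ := by
    unfold familyPos
    rw [if_pos h]
    split_ifs <;> norm_num
  unfold familyFn
  linarith

theorem familyFn_apply (hmeet : ThreeMeet P) (hmiss : ThreeMeet fun j => (P j)ᶜ) (j : Fin g) :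
    familyFn P (P j) = 3 := by
  unfold familyFn
  rw [familyPos_eq_zero hmeet (not_isPositive_compl hmeet hmiss (isPositive_apply hmeet j)),
    sub_zero, familyPos, if_pos ⟨j, rfl⟩]

/-- If `P j`, `T`, `R` partition the items, neither `T` nor `R` is positive, and they cannot both lie
below members of the family, as three members do not cover; one lying below none is negative. -/
theorem familyFn_add_le_of_partition (hmeet : ThreeMeet P) (hmiss : ThreeMeet fun j => (P j)ᶜ)
    {j : Fin g} {T R : Finset (Fin n)} (hT : Disjoint (P j) T) (hR : Disjoint (P j) R)
    (hcov : ∀ i, i ∈ P j ∨ i ∈ T ∨ i ∈ R) : familyFn P T + familyFn P R ≤ -1 := by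
  have hneg : ∀ X : Finset (Fin n), Disjoint (P j) X → (∀ k, ¬ X ⊆ P k) → familyFn P X ≤ -1 := by
    intro X hX h
    refine familyFn_le_neg_one hmeet hmiss (Or.inr ⟨⟨j, ?_⟩, fun k hk => h k ?_⟩)
    · exact Finset.subset_compl_iff_disjoint_right.2 hX
    · exact Finset.compl_subset_compl.1 hk
  have hnonpos : ∀ X : Finset (Fin n), Disjoint (P j) X → familyFn P X ≤ 0 := by
    intro X hX
    refine familyFn_nonpos hmeet ?_
    rintro (⟨-, h⟩ | ⟨⟨k, hk⟩, -⟩)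
    · exact h j (Finset.subset_compl_iff_disjoint_left.2 hX)
    · obtain ⟨i, h1, h2, -⟩ := hmeet j k k
      exact Finset.disjoint_left.1 hX h1 (hk h2)
  by_cases h1 : ∃ k, T ⊆ P k
  · obtain ⟨k, hk⟩ := h1
    have h2 : ∀ l, ¬ R ⊆ P l := by
      intro l hl
      obtain ⟨i, hi1, hi2, hi3⟩ := hmiss j k l
      rw [Finset.mem_compl] at hi1 hi2 hi3
      rcases hcov i with h | h | h
      · exact hi1 h
      · exact hi2 (hk h)
      · exact hi3 (hl h)
    linarith [hneg R hR h2, hnonpos T hT]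
  · push Not at h1
    linarith [hneg T hT h1, hnonpos R hR]

/-- If `S`, `T`, `R` partition the items, they are not all positive: sets below members of the
family do not cover, and sets above members of the family are not disjoint. -/
theorem not_isPositive_of_partition (hmeet : ThreeMeet P) (hmiss : ThreeMeet fun j => (P j)ᶜ)
    {S T R : Finset (Fin n)} (hST : Disjoint S T) (hSR : Disjoint S R)
    (hcov : ∀ i, i ∈ S ∨ i ∈ T ∨ i ∈ R) (hS : IsPositive P S) (hT : IsPositive P T)
    (hR : IsPositive P R) : False := by
  have key : ∀ X Y : Finset (Fin n), Disjoint X Y → IsPositive P Y → ∀ j, ¬ P j ⊆ X := by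
    rintro X Y hXY (⟨-, h⟩ | ⟨⟨k, hk⟩, -⟩) j hj
    · exact h j (Finset.subset_compl_iff_disjoint_left.2 (hXY.mono_left hj))
    · obtain ⟨i, h1, h2, -⟩ := hmeet j k k
      exact Finset.disjoint_left.1 hXY (hj h1) (hk h2)
  have hS' := hS
  rcases hS with ⟨⟨j, hj⟩, -⟩ | ⟨⟨j, hj⟩, -⟩
  · rcases hT with ⟨⟨k, hk⟩, -⟩ | ⟨⟨k, hk⟩, -⟩
    · rcases hR with ⟨⟨l, hl⟩, -⟩ | ⟨⟨l, hl⟩, -⟩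
      · obtain ⟨i, hi1, hi2, hi3⟩ := hmiss j k l
        rw [Finset.mem_compl] at hi1 hi2 hi3
        rcases hcov i with h | h | h
        · exact hi1 (hj h)
        · exact hi2 (hk h)
        · exact hi3 (hl h)
      · exact key R S hSR.symm hS' l hl
    · exact key T S hST.symm hS' k hk
  · exact key S T hST hT j hj

theorem familyFn_sum_le_two (hmeet : ThreeMeet P) (hmiss : ThreeMeet fun j => (P j)ᶜ)
    {S T R : Finset (Fin n)} (hST : Disjoint S T) (hSR : Disjoint S R) (hTR : Disjoint T R)
    (hcov : ∀ i, i ∈ S ∨ i ∈ T ∨ i ∈ R) : familyFn P S + familyFn P T + familyFn P R ≤ 2 := by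
  by_cases h1 : ∃ j, S = P j
  · obtain ⟨j, rfl⟩ := h1
    linarith [familyFn_add_le_of_partition hmeet hmiss hST hSR hcov,
      familyFn_le_three (P := P) (P j)]
  by_cases h2 : ∃ j, T = P j
  · obtain ⟨j, rfl⟩ := h2
    linarith [familyFn_add_le_of_partition hmeet hmiss hST.symm hTR fun i => by
      have := hcov i; tauto, familyFn_le_three (P := P) (P j)]
  by_cases h3 : ∃ j, R = P j
  · obtain ⟨j, rfl⟩ := h3
    linarith [familyFn_add_le_of_partition hmeet hmiss hSR.symm hTR.symm fun i => by
      have := hcov i; tauto, familyFn_le_three (P := P) (P j)]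
  push Not at h1 h2 h3
  have g1 := familyFn_le_one h1
  have g2 := familyFn_le_one h2
  have g3 := familyFn_le_one h3
  by_cases hS : IsPositive P S
  · by_cases hT : IsPositive P T
    · by_cases hR : IsPositive P R
      · exact (not_isPositive_of_partition hmeet hmiss hST hSR hcov hS hT hR).elim
      · linarith [familyFn_nonpos hmeet hR]
    · linarith [familyFn_nonpos hmeet hT]
  · linarith [familyFn_nonpos hmeet hS]

theorem familyFn_empty (hmeet : ThreeMeet P) (hmiss : ThreeMeet fun j => (P j)ᶜ) :
    familyFn P ∅ = 0 := by
  have h1 : ¬ IsPositive P ∅ := by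
    rintro (⟨⟨j, -⟩, h⟩ | ⟨⟨j, hj⟩, -⟩)
    · exact h j (Finset.empty_subset _)
    · obtain ⟨i, hi, -⟩ := hmeet j j j
      exact Finset.notMem_empty i (hj hi)
  have h2 : ¬ IsPositive P ∅ᶜ := by
    rw [Finset.compl_empty]
    rintro (⟨⟨j, hj⟩, -⟩ | ⟨⟨j, -⟩, h⟩)
    · obtain ⟨i, hi, -⟩ := hmiss j j j
      exact Finset.mem_compl.1 hi (hj (Finset.mem_univ i))
    · exact h j (Finset.subset_univ _)
  rw [familyFn, familyPos_eq_zero hmeet h1, familyPos_eq_zero hmeet h2, sub_zero]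

/-- With `f ∅ = 0` and antisymmetry, weak `2`-modularity says `|f S + f T + f R| ≤ 2` for every
partition of the items into `S`, `T`, `R`; the lower bound is the upper one for the family of
complements. -/
theorem isWeaklyModular_familyFn (hmeet : ThreeMeet P) (hmiss : ThreeMeet fun j => (P j)ᶜ) :
    IsWeaklyModular 2 fun S => (familyFn P S : ℝ) := by
  intro S T hST
  have hSR : Disjoint S (S ∪ T)ᶜ :=
    (disjoint_compl_right (a := S ∪ T)).mono_left Finset.subset_union_left
  have hTR : Disjoint T (S ∪ T)ᶜ :=
    (disjoint_compl_right (a := S ∪ T)).mono_left Finset.subset_union_right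
  have hcov : ∀ i, i ∈ S ∨ i ∈ T ∨ i ∈ (S ∪ T)ᶜ := by
    intro i
    rw [Finset.mem_compl, Finset.mem_union]
    tauto
  have hup := familyFn_sum_le_two hmeet hmiss hST hSR hTR hcov
  have hmeet' : ThreeMeet fun j => ((P j)ᶜ)ᶜ := by simpa only [compl_compl] using hmeet
  have hlow := familyFn_sum_le_two hmiss hmeet' hST hSR hTR hcov
  simp only [familyFn_compl_family, familyFn_compl] at hup hlow
  simp only [Finset.disjoint_iff_inter_eq_empty.1 hST, familyFn_empty hmeet hmiss, abs_le,
    Int.cast_zero]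
  constructor
  · have : -2 ≤ familyFn P S + familyFn P T - familyFn P (S ∪ T) - 0 := by linarith
    exact_mod_cast this
  · have : familyFn P S + familyFn P T - familyFn P (S ∪ T) - 0 ≤ 2 := by linarith
    exact_mod_cast this

end Family

/-! ### Circuits -/

theorem eval_permPreimage {g n : ℕ} (π : Equiv.Perm (Fin n)) (G : Fin g → Finset (Fin n))
    (C : Circuit g) : C.eval (fun j => permPreimage π (G j)) = permPreimage π (C.eval G) := by
  induction C with
  | input j => rfl
  | compl C ih => rw [Circuit.eval, Circuit.eval, ih, permPreimage_compl]
  | inter C D ihC ihD => rw [Circuit.eval, Circuit.eval, ihC, ihD]; ext i; simp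
  | union C D ihC ihD => rw [Circuit.eval, Circuit.eval, ihC, ihD]; ext i; simp

/-- De Morgan: the dual circuit computes the complement of what the circuit computes from the
complements of the inputs. -/
theorem eval_dual {g n : ℕ} (G : Fin g → Finset (Fin n)) (C : Circuit g) :
    C.dual.eval G = (C.eval fun j => (G j)ᶜ)ᶜ := by
  induction C with
  | input j => simp [Circuit.dual, Circuit.eval]
  | compl C ih => rw [Circuit.dual, Circuit.eval, Circuit.eval, ih]
  | inter C D ihC ihD =>
    rw [Circuit.dual, Circuit.eval, Circuit.eval, ihC, ihD, Finset.compl_inter]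
  | union C D ihC ihD =>
    rw [Circuit.dual, Circuit.eval, Circuit.eval, ihC, ihD, Finset.compl_union]

/-! ### Twenty items -/

/-- The items are labelled by the `3`-element subsets of `{0, …, 5}`. -/
noncomputable def itemEquiv : Fin 20 ≃ {A : Finset (Fin 6) // A.card = 3} :=
  (Fintype.equivFinOfCardEq (by rw [Fintype.card_finset_len]; rfl)).symm

/-- The set of the ten items whose label contains `j`. -/
noncomputable def itemFamily (j : Fin 6) : Finset (Fin 20) :=
  Finset.univ.filter fun i => j ∈ (itemEquiv i).1

theorem mem_itemFamily {j : Fin 6} {i : Fin 20} : i ∈ itemFamily j ↔ j ∈ (itemEquiv i).1 := by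
  simp [itemFamily]

theorem exists_item (A : Finset (Fin 6)) (hA : A.card = 3) :
    ∃ i, ∀ j, i ∈ itemFamily j ↔ j ∈ A :=
  ⟨itemEquiv.symm ⟨A, hA⟩, fun j => by rw [mem_itemFamily, Equiv.apply_symm_apply]⟩

theorem item_ext {i i' : Fin 20} (h : ∀ j, i ∈ itemFamily j → i' ∈ itemFamily j) : i' = i := by
  apply itemEquiv.injective
  apply Subtype.ext
  refine (Finset.eq_of_subset_of_card_le (fun j hj => ?_) ?_).symm
  · exact mem_itemFamily.1 (h j (mem_itemFamily.2 hj))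
  · rw [(itemEquiv i).2, (itemEquiv i').2]

/-- A permutation of the labels' elements permutes the items. -/
theorem exists_perm_reindex (σ : Equiv.Perm (Fin 6)) :
    ∃ π : Equiv.Perm (Fin 20), ∀ j, itemFamily (σ j) = permPreimage π (itemFamily j) := by
  let e : {A : Finset (Fin 6) // A.card = 3} ≃ {A : Finset (Fin 6) // A.card = 3} :=
    (Equiv.finsetCongr σ.symm).subtypeEquiv fun A => by simp
  refine ⟨(itemEquiv.trans e).trans itemEquiv.symm, fun j => ?_⟩
  ext i
  simp [mem_itemFamily, e]

/-- Complementing the labels permutes the items. -/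
theorem exists_perm_compl :
    ∃ π : Equiv.Perm (Fin 20), ∀ j, (itemFamily j)ᶜ = permPreimage π (itemFamily j) := by
  let e : {A : Finset (Fin 6) // A.card = 3} ≃ {A : Finset (Fin 6) // A.card = 3} :=
    (Equiv.mk (fun A : Finset (Fin 6) => Aᶜ) (fun A => Aᶜ) compl_compl compl_compl).subtypeEquiv
      fun A => by
        have := Finset.card_add_card_compl A
        rw [Fintype.card_fin] at this
        simp only [Equiv.coe_fn_mk]
        omega
  refine ⟨(itemEquiv.trans e).trans itemEquiv.symm, fun j => ?_⟩
  ext i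
  simp [mem_itemFamily, e]

theorem threeMeet_itemFamily : ThreeMeet itemFamily := by
  intro j k l
  obtain ⟨A, hA, hc⟩ := Finset.exists_superset_card_eq (s := {j, k, l}) (n := 3)
    Finset.card_le_three (by simp)
  obtain ⟨i, hi⟩ := exists_item A hc
  exact ⟨i, (hi j).2 (hA (by simp)), (hi k).2 (hA (by simp)), (hi l).2 (hA (by simp))⟩

theorem threeMeet_compl_itemFamily : ThreeMeet fun j => (itemFamily j)ᶜ := by
  obtain ⟨π, hπ⟩ := exists_perm_compl
  intro j k l
  obtain ⟨i, h1, h2, h3⟩ := threeMeet_itemFamily j k l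
  refine ⟨π.symm i, ?_⟩
  simp only [hπ, mem_permPreimage, Equiv.apply_symm_apply]
  exact ⟨h1, h2, h3⟩

theorem card_itemFamily (j : Fin 6) : (itemFamily j).card = 10 := by
  have h1 : (itemFamily j).card =
      (Finset.univ.filter fun A : {A : Finset (Fin 6) // A.card = 3} => j ∈ A.1).card := by
    refine Finset.card_bij (fun i _ => itemEquiv i) ?_ (fun i _ i' _ h => itemEquiv.injective h) ?_
    · intro i hi
      simpa [mem_itemFamily] using hi
    · intro A hA
      refine ⟨itemEquiv.symm A, ?_, by simp⟩
      simpa [mem_itemFamily] using hA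
  rw [h1]
  clear h1
  revert j
  decide

theorem card_filter_mem_itemFamily (i : Fin 20) :
    (Finset.univ.filter fun j => i ∈ itemFamily j).card = 3 := by
  simp [mem_itemFamily, (itemEquiv i).2]

theorem card_filter_mem_compl_itemFamily (i : Fin 20) :
    (Finset.univ.filter fun j => i ∈ (itemFamily j)ᶜ).card = 3 := by
  have := Finset.card_filter_add_card_filter_not (s := (Finset.univ : Finset (Fin 6)))
    (fun j => i ∈ itemFamily j)
  rw [card_filter_mem_itemFamily, Finset.card_univ, Fintype.card_fin] at this
  simp only [Finset.mem_compl]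
  omega

theorem isCanonical_of_item_ext {G : Fin (2 * 3) → Finset (Fin 20)}
    (hfreq : ∀ i, (Finset.univ.filter fun j => i ∈ G j).card = 3) (hhalf : ∀ j, (G j).card = 10)
    (hext : ∀ i i', (∀ j, i ∈ G j → i' ∈ G j) → i' = i) : IsCanonical 3 G where
  pos := by norm_num
  generating :=
    { covering := by
        refine Set.eq_univ_of_forall fun i => ?_
        have : (Finset.univ.filter fun j => i ∈ G j).Nonempty := by
          rw [← Finset.card_pos, hfreq]; norm_num
        obtain ⟨j, hj⟩ := this
        exact Set.mem_iUnion.2 ⟨j, (Finset.mem_filter.1 hj).2⟩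
      differentiating := by
        intro i
        ext i'
        simp only [Set.mem_iInter, Set.mem_ofPred_eq, Finset.mem_coe, Set.mem_singleton_iff]
        exact ⟨fun h => hext i i' h, fun h j hj => h ▸ hj⟩ }
  frequency := hfreq
  half := fun j => by rw [hhalf]
  card_items := by decide

theorem isCanonical_itemFamily : IsCanonical 3 itemFamily :=
  isCanonical_of_item_ext card_filter_mem_itemFamily card_itemFamily fun _ _ => item_ext

theorem isCanonical_compl_itemFamily : IsCanonical 3 fun j => (itemFamily j)ᶜ := by
  refine isCanonical_of_item_ext card_filter_mem_compl_itemFamily (fun j => ?_) fun i i' h => ?_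
  · rw [Finset.card_compl, card_itemFamily, Fintype.card_fin]
  · refine (item_ext fun j hj => ?_).symm
    by_contra hn
    exact Finset.mem_compl.1 (h j (Finset.mem_compl.2 hn)) hj

theorem itemFamily_injective : Function.Injective itemFamily := by
  intro j k h
  by_contra hne
  obtain ⟨A, hA, hA', hc⟩ := Finset.exists_subsuperset_card_eq (s := {j}) (t := {k}ᶜ) (n := 3)
    (by simpa using Ne.symm hne) (by simp) (by rw [Finset.card_compl]; simp)
  obtain ⟨i, hi⟩ := exists_item A hc
  have h1 : i ∈ itemFamily j := (hi j).2 (hA (by simp))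
  rw [h, hi] at h1
  simpa using hA' h1

/-- The real valued function over twenty items with values `3` on `itemFamily` and `-3` on the
complements. -/
noncomputable def twentyFn (S : Finset (Fin 20)) : ℝ := (familyFn itemFamily S : ℝ)

theorem twentyFn_compl (S : Finset (Fin 20)) : twentyFn Sᶜ = -twentyFn S := by
  simp [twentyFn, familyFn_compl]

theorem twentyFn_itemFamily (j : Fin 6) : twentyFn (itemFamily j) = 3 := by
  rw [twentyFn, familyFn_apply threeMeet_itemFamily threeMeet_compl_itemFamily]
  norm_num

theorem abs_twentyFn_le (S : Finset (Fin 20)) : |twentyFn S| ≤ 3 := by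
  have h1 := familyFn_le_three (P := itemFamily) S
  have h2 := familyFn_le_three (P := itemFamily) Sᶜ
  rw [familyFn_compl] at h2
  rw [twentyFn, abs_le]
  constructor
  · exact_mod_cast (by linarith : -3 ≤ familyFn itemFamily S)
  · exact_mod_cast h1

theorem isWeaklyModular_twentyFn : IsWeaklyModular 2 twentyFn :=
  isWeaklyModular_familyFn threeMeet_itemFamily threeMeet_compl_itemFamily

/-- A linear function has the same average over the family and over the complements, as every item
lies in half of the members, whereas these averages of `twentyFn` are `3` and `-3`. -/
theorem isTightlyLinear_twentyFn : IsTightlyLinear 3 twentyFn := by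
  refine ⟨⟨fun _ => 0, ⟨0, 0, fun S => by simp⟩, fun S => by simpa using abs_twentyFn_le S⟩, ?_⟩
  rintro Δ hΔ ⟨l, ⟨c₀, c, hl⟩, hclose⟩
  have hswap : ∀ G : Fin 6 → Finset (Fin 20),
      (∀ i, (Finset.univ.filter fun j => i ∈ G j).card = 3) →
      ∑ j, l (G j) = 6 * c₀ + 3 * ∑ i, c i := by
    intro G hG
    simp only [hl, Finset.sum_add_distrib, Finset.sum_const, Finset.card_univ, Fintype.card_fin,
      nsmul_eq_mul, Nat.cast_ofNat]
    congr 1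
    rw [Finset.sum_comm' (t' := Finset.univ) (s' := fun i => Finset.univ.filter fun j => i ∈ G j)
      (by simp)]
    simp [hG, Finset.mul_sum]
  have h1 := hswap _ card_filter_mem_itemFamily
  have h2 := hswap _ card_filter_mem_compl_itemFamily
  have h3 : ∑ j, l (itemFamily j) ≥ ∑ _j : Fin 6, (3 - Δ) := by
    refine Finset.sum_le_sum fun j _ => ?_
    have := (abs_le.1 (hclose (itemFamily j))).2
    rw [twentyFn_itemFamily] at this
    linarith
  have h4 : ∑ j, l (itemFamily j)ᶜ ≤ ∑ _j : Fin 6, (Δ - 3) := by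
    refine Finset.sum_le_sum fun j _ => ?_
    have := (abs_le.1 (hclose (itemFamily j)ᶜ)).1
    rw [twentyFn_compl, twentyFn_itemFamily] at this
    linarith
  simp only [Finset.sum_const, Finset.card_univ, Fintype.card_fin, nsmul_eq_mul,
    Nat.cast_ofNat] at h3 h4
  linarith

theorem twentyFn_eval_reindex (C : Circuit 6) (σ : Equiv.Perm (Fin 6)) :
    twentyFn (C.eval fun j => itemFamily (σ j)) = twentyFn (C.eval itemFamily) := by
  obtain ⟨π, hπ⟩ := exists_perm_reindex σ
  unfold twentyFn
  rw [← familyFn_reindex itemFamily σ (C.eval _)]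
  simp only [hπ]
  rw [eval_permPreimage, familyFn_permPreimage]

theorem twentyFn_eval_dual (C : Circuit 6) :
    twentyFn (C.dual.eval itemFamily) = twentyFn (C.eval itemFamily) := by
  obtain ⟨π, hπ⟩ := exists_perm_compl
  rw [eval_dual, twentyFn_compl]
  unfold twentyFn
  rw [← Int.cast_neg, ← familyFn_compl_family]
  simp only [hπ]
  rw [eval_permPreimage, familyFn_permPreimage]

/-- The uniform distribution on the members of an injective family of six sets. -/
theorem exists_uniform {G : Fin 6 → Finset (Fin 20)} (hG : Function.Injective G)
    (hfreq : ∀ i, (Finset.univ.filter fun j => i ∈ G j).card = 3) :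
    ∃ p : Finset (Fin 20) → ℚ, IsDistribution p ∧ {S | 0 < p S} = Set.range G ∧
      ∀ i, marginal p i = 1 / 2 := by
  classical
  have hsum : ∀ F : Finset (Finset (Fin 20)),
      ∑ S ∈ F, (if S ∈ Finset.univ.image G then (1 / 6 : ℚ) else 0) =
        (Finset.univ.filter fun j => G j ∈ F).card * (1 / 6) := by
    intro F
    rw [← Finset.sum_filter, Finset.sum_const, nsmul_eq_mul]
    congr 2
    rw [← Finset.card_image_of_injective _ hG]
    congr 1
    ext S
    simp only [Finset.mem_filter, Finset.mem_image, Finset.mem_univ, true_and]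
    constructor
    · rintro ⟨h, j, rfl⟩
      exact ⟨j, h, rfl⟩
    · rintro ⟨j, h, rfl⟩
      exact ⟨h, j, rfl⟩
  refine ⟨fun S => if S ∈ Finset.univ.image G then 1 / 6 else 0, ⟨fun S => ?_, ?_⟩, ?_, fun i => ?_⟩
  · split_ifs <;> norm_num
  · rw [hsum]
    simp
  · ext S
    simp only [Set.mem_ofPred_eq, Set.mem_range]
    split_ifs with h
    · simpa using h
    · simpa using h
  · rw [marginal, hsum]
    simp only [Finset.mem_filter, Finset.mem_univ, true_and, hfreq]
    norm_num

theorem isSupportPair_twentyFn : IsSupportPair twentyFn (Set.range itemFamily)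
    (Set.range fun j => (itemFamily j)ᶜ) := by
  obtain ⟨p, hp, hps, hpm⟩ := exists_uniform itemFamily_injective card_filter_mem_itemFamily
  obtain ⟨q, hq, hqs, hqm⟩ := exists_uniform (G := fun j => (itemFamily j)ᶜ)
    (compl_injective.comp itemFamily_injective) card_filter_mem_compl_itemFamily
  refine ⟨3, p, q, ⟨⟨itemFamily 0, by simp [twentyFn_itemFamily]⟩, ?_⟩, hp, hq, fun S hS => ?_,
    fun S hS => ?_, fun i => by rw [hpm, hqm], hps.symm, hqs.symm⟩
  · rintro _ ⟨S, rfl⟩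
    exact abs_twentyFn_le S
  · have : S ∈ Set.range itemFamily := hps ▸ hS
    obtain ⟨j, rfl⟩ := this
    exact twentyFn_itemFamily j
  · have : S ∈ Set.range fun j => (itemFamily j)ᶜ := hqs ▸ hS
    obtain ⟨j, rfl⟩ := this
    rw [twentyFn_compl, twentyFn_itemFamily]

theorem isIntegerValued_twentyFn : IsIntegerValued twentyFn := fun S => ⟨familyFn itemFamily S, rfl⟩

theorem isKMSymmetric_twentyFn : IsKMSymmetric 3 3 twentyFn := by
  refine ⟨itemFamily, ?_⟩
  exact
  { two_le := by norm_num
    one_le := by norm_num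
    card_items := by decide
    closest_zero := ⟨⟨0, 0, fun S => by simp⟩, 3, isTightlyLinear_twentyFn,
      fun S => by simpa using abs_twentyFn_le S⟩
    integrality := isIntegerValued_twentyFn
    antisymmetry := fun S => by rw [twentyFn_compl, neg_neg]
    supports := isSupportPair_twentyFn
    value_pos := fun j => by rw [twentyFn_itemFamily]; norm_num
    value_neg := fun j => by rw [twentyFn_compl, twentyFn_itemFamily]; norm_num
    canonical_pos := isCanonical_itemFamily
    canonical_neg := isCanonical_compl_itemFamily
    anonymity := fun C σ τ => by
      rw [twentyFn_eval_reindex C σ, twentyFn_eval_reindex C τ]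
    dual_symmetry := by
      rintro _ _ ⟨C, σ, rfl, rfl⟩
      rw [twentyFn_eval_reindex C σ, twentyFn_eval_reindex C.dual σ, twentyFn_eval_dual] }

end SetFn

theorem theorem3 :
    (∀ (n : ℕ) (ε : ℝ), 0 < ε → ∀ f : Finset (Fin n) → ℝ, SetFn.IsWeaklyModular ε f →
      ∃ Δ : ℝ, Δ < 24 * ε ∧ SetFn.IsDeltaLinear Δ f) ∧
    (∃! K : ℝ, SetFn.IsWeakKaltonConstant K) ∧
    (∀ K : ℝ, SetFn.IsWeakKaltonConstant K → 3 / 2 ≤ K ∧ K ≤ 23.811 ∧ K < 24) ∧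
    (∃ f : Finset (Fin 20) → ℝ, SetFn.IsIntegerValued f ∧ SetFn.IsWeaklyModular 2 f ∧
      SetFn.IsTightlyLinear 3 f ∧ SetFn.IsKMSymmetric 3 3 f) := by
  refine ⟨fun n ε hε f hf =>
      ⟨21 * ε, by linarith, SetFn.isDeltaLinear_of_isWeaklyModular hε.le hf⟩,
    SetFn.existsUnique_isWeakKaltonConstant, fun K hK => ?_,
    SetFn.twentyFn, SetFn.isIntegerValued_twentyFn, SetFn.isWeaklyModular_twentyFn,
    SetFn.isTightlyLinear_twentyFn, SetFn.isKMSymmetric_twentyFn⟩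
  have hle : K ≤ 21 := hK.le fun n f hf => by
    simpa using SetFn.isDeltaLinear_of_isWeaklyModular zero_le_one hf
  have hge : 3 / 2 ≤ K := by
    by_contra! hlt
    exact SetFn.isTightlyLinear_twentyFn.2 (K * 2) (by linarith)
      (hK.upper 20 2 zero_le_two _ SetFn.isWeaklyModular_twentyFn)
  exact ⟨hge, by norm_num; linarith, by linarith⟩
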